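/- Let $M$ be a closed (compact, without boundary) oriented smooth $3$-manifold with a smooth Riemannian metric $g=\langle\cdot,\cdot\rangle$, and let $\alpha$ be a smooth contact form on $M$, that is, a $1$-form with $\alpha\wedge d\alpha\neq 0$ everywhere. Put $\xi=\ker\alpha$. Suppose that $g$ is adapted to $\alpha$, that is, $\ast\,d\alpha=\mu\,\alpha$ for some $\mu\in C^\infty(M)$ with $\mu\neq 0$ everywhere, where $\ast$ is the Hodge star of $g$. Let $X$ be a smooth nowhere vanishing vector field on $M$ that preserves $\alpha$, that is, $\mathcal L_X\alpha=0$; in particular, $X$ is a contact vector field for $\xi$. Let $f=\alpha(X)$, and let $\Gamma_X=\{p\in M: X_p\in\xi_p\}$ be the characteristic surface of $X$. Put $v=\|X\|$, $e_1=X/v$, $\eta_1=\langle e_1,\cdot\rangle$ and $\mathcal E=(\ast\,d\eta_1)(e_1)$. Let $\nabla^2 f$ be the Hessian of $f$ with respect to the Levi-Civita connection and $\Delta_M f=-\operatorname{tr}\nabla^2 f$ the (nonnegative) Laplacian. Then: 1. $\Gamma_X=f^{-1}(0)$, and $f$ is a smooth solution on $M$ of the subelliptic equation $$\Delta_M f+\frac{1}{v^2}\nabla^2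 f(X,X)-\Bigl\langle\nabla\ln\frac{1}{|\mu|\,v},\nabla f\Bigr\rangle+\mu(\mathcal E-\mu)f=0 ,$$ so that $\Gamma_X$ is the zero set (nodal set) of this solution. 2. $\Gamma_X$ is a finite (possibly empty) disjoint union of smoothly embedded $2$-tori: there are an integer $n\geq 0$ and smooth embeddings $T_1,\dots,T_n: S^1\times S^1\to M$ with pairwise disjoint images such that $\Gamma_X=\bigcup_{i=1}^n T_i(S^1\times S^1)$. -/

import Mathlib

open Bundle
open scoped Manifold ContDiff

noncomputable section

namespace ContactGeometry

/-- The model space of 3-manifolds. -/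
abbrev E3 : Type := EuclideanSpace ℝ (Fin 3)

section Smooth

variable {M : Type*} [TopologicalSpace M] [ChartedSpace E3 M]

/-- Vector fields (not assumed to be smooth). -/
abbrev VField (M : Type*) [TopologicalSpace M] [ChartedSpace E3 M] : Type _ :=
  (p : M) → TangentSpace (𝓡 3) p

/-- Fields of covectors, that is, 1-forms (not assumed to be smooth). -/
abbrev OneForm (M : Type*) [TopologicalSpace M] [ChartedSpace E3 M] : Type _ :=
  (p : M) → (TangentSpace (𝓡 3) p →L[ℝ] ℝ)

/-- Smoothness of a vector field, as a section of the tangent bundle. -/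
def VField.IsSmooth [IsManifold (𝓡 3) ∞ M] (X : VField M) : Prop :=
  ContMDiff (𝓡 3) ((𝓡 3).prod 𝓘(ℝ, E3)) ∞
    (fun p => Bundle.TotalSpace.mk' E3 (E := fun p : M => TangentSpace (𝓡 3) p) p (X p))

/-- Smoothness of a 1-form, as a section of the cotangent bundle. -/
def OneForm.IsSmooth [IsManifold (𝓡 3) ∞ M] (α : OneForm M) : Prop :=
  ContMDiff (𝓡 3) ((𝓡 3).prod 𝓘(ℝ, E3 →L[ℝ] ℝ)) ∞
    (fun p => Bundle.TotalSpace.mk' (E3 →L[ℝ] ℝ)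
      (E := fun p : M => TangentSpace (𝓡 3) p →L[ℝ] ℝ) p (α p))

/-- A vector field that is smooth near `p` and has the value `u` at `p`. -/
abbrev ext [IsManifold (𝓡 3) ∞ M] {p : M} (u : TangentSpace (𝓡 3) p) : VField M :=
  FiberBundle.extend E3 u

/-- The function `α(Y)`. -/
def pair (α : OneForm M) (Y : VField M) : M → ℝ := fun p => α p (Y p)

/-- The exterior derivative of a 1-form, `dα(U, V) = U(α(V)) - V(α(U)) - α([U, V])`,
where `U, V` are vector fields extending the given vectors. -/
def dForm [IsManifold (𝓡 3) ∞ M] (α : OneForm M) (p : M) (u v : TangentSpace (𝓡 3) p) : ℝ :=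
  mvfderiv (𝓡 3) (pair α (ext v)) p u - mvfderiv (𝓡 3) (pair α (ext u)) p v
    - α p (VectorField.mlieBracket (𝓡 3) (ext u) (ext v) p)

/-- The Lie derivative of a 1-form, `(L_X α)(U) = X(α(U)) - α([X, U])`,
where `U` is a vector field extending the given vector. -/
def lieDerivForm [IsManifold (𝓡 3) ∞ M] (X : VField M) (α : OneForm M) (p : M)
    (u : TangentSpace (𝓡 3) p) : ℝ :=
  mvfderiv (𝓡 3) (pair α (ext u)) p (X p) - α p (VectorField.mlieBracket (𝓡 3) X (ext u) p)

/-- The vector field `X` preserves the form `α`: `L_X α = 0`. -/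
def Preserves [IsManifold (𝓡 3) ∞ M] (X : VField M) (α : OneForm M) : Prop :=
  ∀ (p : M) (u : TangentSpace (𝓡 3) p), lieDerivForm X α p u = 0

/-- A contact form: a smooth 1-form with `α ∧ dα` nowhere zero. -/
structure IsContactForm [IsManifold (𝓡 3) ∞ M] (α : OneForm M) : Prop where
  smooth : α.IsSmooth
  nonintegrable : ∀ p : M, ∃ u v w : TangentSpace (𝓡 3) p,
    α p u * dForm α p v w + α p v * dForm α p w u + α p w * dForm α p u v ≠ 0

/-- The contact plane `ξ_p = ker α_p`. -/
def contactPlane (α : OneForm M) (p : M) : Submodule ℝ (TangentSpace (𝓡 3) p) :=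
  LinearMap.ker (α p).toLinearMap

/-- The characteristic surface of `X`: the set of points where `X` is tangent to `ξ = ker α`. -/
def charSurface (α : OneForm M) (X : VField M) : Set M :=
  {p | X p ∈ contactPlane α p}

/-- A choice of an orientation of each tangent space is an orientation of the manifold if near
every point it is given by a smooth local frame. -/
def IsOrientation [IsManifold (𝓡 3) ∞ M]
    (o : (p : M) → Orientation ℝ (TangentSpace (𝓡 3) p) (Fin 3)) : Prop :=
  ∀ p : M, ∃ s : Fin 3 → VField M,
    (∀ i, ContMDiffAt (𝓡 3) ((𝓡 3).prod 𝓘(ℝ, E3)) ∞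
      (fun q => Bundle.TotalSpace.mk' E3 (E := fun q : M => TangentSpace (𝓡 3) q) q (s i q)) p) ∧
    ∀ᶠ q in nhds p, ∃ b : Module.Basis (Fin 3) ℝ (TangentSpace (𝓡 3) q),
      (∀ i, b i = s i q) ∧ b.orientation = o q

/-- `S` is a finite (possibly empty) disjoint union of smoothly embedded 2-tori. -/
def IsFiniteDisjointUnionOfTori [IsManifold (𝓡 3) ∞ M] (S : Set M) : Prop :=
  ∃ (n : ℕ) (T : Fin n → (Circle × Circle → M)),
    (∀ i, Manifold.IsSmoothEmbedding ((𝓡 1).prod (𝓡 1)) (𝓡 3) ∞ (T i)) ∧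
    Pairwise (fun i j => Disjoint (Set.range (T i)) (Set.range (T j))) ∧
    S = ⋃ i, Set.range (T i)

instance (p : M) : FiniteDimensional ℝ (TangentSpace (𝓡 3) p) :=
  inferInstanceAs (FiniteDimensional ℝ E3)

theorem finrank_tangentSpace (p : M) : Module.finrank ℝ (TangentSpace (𝓡 3) p) = 3 :=
  finrank_euclideanSpace_fin (𝕜 := ℝ) (n := 3)

end Smooth

/-- The Hodge star of a 2-form on an oriented Euclidean space of dimension three: if `b` is a
positively oriented orthonormal basis with dual basis `η`, then
`*(η₁ ∧ η₂) = η₀`, `*(η₂ ∧ η₀) = η₁` and `*(η₀ ∧ η₁) = η₂`. -/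
def hodgeStar {V : Type*} [NormedAddCommGroup V] [InnerProductSpace ℝ V]
    (hV : Module.finrank ℝ V = 3) (o : Orientation ℝ V (Fin 3)) (β : V → V → ℝ) (u : V) : ℝ :=
  let b := o.finOrthonormalBasis (by norm_num) hV
  β (b 1) (b 2) * inner ℝ (b 0) u + β (b 2) (b 0) * inner ℝ (b 1) u
    + β (b 0) (b 1) * inner ℝ (b 2) u

section Riemannian

variable {M : Type*} [TopologicalSpace M] [ChartedSpace E3 M] [IsManifold (𝓡 3) ∞ M]
  [RiemannianBundle (fun p : M => TangentSpace (𝓡 3) p)]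

/-- The metric is adapted to `α`: `*dα = μ α` for the nowhere zero smooth function `μ`. -/
structure IsAdapted (o : (p : M) → Orientation ℝ (TangentSpace (𝓡 3) p) (Fin 3))
    (α : OneForm M) (μ : M → ℝ) : Prop where
  smooth : ContMDiff (𝓡 3) 𝓘(ℝ, ℝ) ∞ μ
  ne_zero : ∀ p, μ p ≠ 0
  beltrami : ∀ (p : M) (u : TangentSpace (𝓡 3) p),
    hodgeStar (finrank_tangentSpace p) (o p) (dForm α p) u = μ p * α p u

/-- The function `⟨Y, Z⟩`. -/
def metric (Y Z : VField M) : M → ℝ := fun p => inner ℝ (Y p) (Z p)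

/-- The gradient of a function. -/
def grad (f : M → ℝ) : VField M := fun p =>
  haveI : CompleteSpace (TangentSpace (𝓡 3) p) := FiniteDimensional.complete ℝ _
  (InnerProductSpace.toDual ℝ (TangentSpace (𝓡 3) p)).symm (mvfderiv (𝓡 3) f p)

/-- The right-hand side of the Koszul formula for `⟨D_U Y, Z⟩`. -/
def koszul (U Y Z : VField M) (p : M) : ℝ :=
  (1 / 2) *
    (mvfderiv (𝓡 3) (metric Y Z) p (U p) + mvfderiv (𝓡 3) (metric U Z) p (Y p)
      - mvfderiv (𝓡 3) (metric U Y) p (Z p)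
      + inner ℝ (VectorField.mlieBracket (𝓡 3) U Y p) (Z p)
      - inner ℝ (VectorField.mlieBracket (𝓡 3) U Z p) (Y p)
      - inner ℝ (VectorField.mlieBracket (𝓡 3) Y Z p) (U p))

/-- The Levi-Civita covariant derivative `D_u Y` at `p`, given by the Koszul formula. -/
def leviCivita {p : M} (u : TangentSpace (𝓡 3) p) (Y : VField M) : TangentSpace (𝓡 3) p :=
  let b := stdOrthonormalBasis ℝ (TangentSpace (𝓡 3) p)
  ∑ i, koszul (ext u) Y (ext (b i)) p • b i

/-- The Hessian `∇²f(u, v) = ⟨D_u ∇f, v⟩`. -/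
def hess (f : M → ℝ) (p : M) (u v : TangentSpace (𝓡 3) p) : ℝ :=
  inner ℝ (leviCivita u (grad f)) v

/-- The (nonnegative) Laplacian `Δ f = - tr ∇²f`. -/
def laplacian (f : M → ℝ) (p : M) : ℝ :=
  -∑ i, hess f p (stdOrthonormalBasis ℝ (TangentSpace (𝓡 3) p) i)
    (stdOrthonormalBasis ℝ (TangentSpace (𝓡 3) p) i)

/-- The unit field `e₁ = X / ‖X‖`. -/
def unitField (X : VField M) : VField M := fun p => ‖X p‖⁻¹ • X p

/-- The 1-form `η₁ = ⟨e₁, ·⟩`. -/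
def unitForm (X : VField M) : OneForm M := fun p => innerSL ℝ (unitField X p)

/-- The function `ℰ = (*dη₁)(e₁)`. -/
def twist (o : (p : M) → Orientation ℝ (TangentSpace (𝓡 3) p) (Fin 3)) (X : VField M)
    (p : M) : ℝ :=
  hodgeStar (finrank_tangentSpace p) (o p) (dForm (unitForm X) p) (unitField X p)

/-- `f` is a smooth solution of the subelliptic equation
`Δ f + v⁻² ∇²f(X, X) - ⟨∇ ln |1 / (μ v)|, ∇f⟩ + μ (ℰ - μ) f = 0`, where `v = ‖X‖`.
Note that `Real.log x = ln |x|`. -/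
structure IsSubellipticSolution (o : (p : M) → Orientation ℝ (TangentSpace (𝓡 3) p) (Fin 3))
    (X : VField M) (μ f : M → ℝ) : Prop where
  smooth : ContMDiff (𝓡 3) 𝓘(ℝ, ℝ) ∞ f
  equation : ∀ p : M,
    laplacian f p + 1 / ‖X p‖ ^ 2 * hess f p (X p) (X p)
      - inner ℝ (grad (fun q => Real.log (1 / (μ q * ‖X q‖))) p) (grad f p)
      + μ p * (twist o X p - μ p) * f p = 0

end Riemannian

end ContactGeometry

end

noncomputable section

namespace ContactGeometry

open Set Filter Topology VectorField

/-! ### Derivations, brackets and exterior derivatives on a 3-manifold. -/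

section Calculus
variable {M : Type*} [TopologicalSpace M] [ChartedSpace E3 M] [IsManifold (𝓡 3) ∞ M]
-- Both claims come from Cartan's formula: `L_X α = 0` means `df = -ι_X dα` for `f = α(X)`
-- (`mvfderiv_eq_neg_dForm`).
--
-- Equation. Take a local orthonormal frame `e₀ = X/v, e₁, e₂`. Adaptedness says `dα(e₁, e₂) = m
-- α(e₀)` and cyclically, where `m = ±μ` according to the orientation of the frame
-- (`exists_signed_factor`). Two of these identities, combined with `df = -ι_X dα`, express `α(e₁)`
-- and `α(e₂)` through the derivatives of `f` divided by `v m`; moreover `df(e₀) = 0`. The third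
-- identity, expanded as `e₁(α(e₂)) - e₂(α(e₁)) - α([e₁, e₂]) = m α(e₀)`, is then a second order
-- equation for `f`. Its second order part is the trace of the Hessian over the plane `e₁, e₂`, the
-- derivatives of `1/(v m)` give the gradient of the logarithm, and the `e₀`-component of `[e₁, e₂]`
-- gives `ℰ`. This is `subelliptic_equation`.
--
-- Tori. The Reeb field `R` is the metric dual of `α`, rescaled; adaptedness puts it in the kernel
-- of `dα`. Since `X` preserves `α` it commutes with `R` (`mlieBracket_reeb`), and both fields
-- annihilate `f`. On `f = 0` the differential of `f` does not vanish, because `α(X) = 0` and `ι_X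
-- dα = 0` would force `X = 0`; and `R, X` are independent there, as `α(R) = 1`, `α(X) = 0` and `X ≠
-- 0`. So the commuting flows define a locally free action of the plane on the compact surface `f =
-- 0` (`exists_flow_action`). Its orbits are open, hence closed and finite in number, and each is
-- the plane modulo a lattice (`exists_period_basis`), which `exists_torus_embedding` turns into an
-- embedded torus.
theorem nat_le_infty (n : ℕ) : (n : WithTop ℕ∞) ≤ ∞ := by
  exact_mod_cast (le_top : (n : ℕ∞) ≤ ⊤)

variable (M) in
theorem isManifold_minSmoothness (n : ℕ) : IsManifold (𝓡 3) (minSmoothness ℝ n) M := by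
  rw [minSmoothness_of_isRCLikeNormedField]
  exact IsManifold.of_le (n := ∞) (nat_le_infty n)

/-- Smoothness of a vector field at a point. -/
abbrev SmoothAt (U : VField M) (p : M) : Prop :=
  ContMDiffAt (𝓡 3) ((𝓡 3).prod 𝓘(ℝ, E3)) ∞
    (fun q => Bundle.TotalSpace.mk' E3 (E := fun q : M => TangentSpace (𝓡 3) q) q (U q)) p

/-- Differentiability of a vector field at a point. -/
abbrev DiffAt (U : VField M) (p : M) : Prop :=
  MDifferentiableAt (𝓡 3) ((𝓡 3).prod 𝓘(ℝ, E3))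
    (fun q => Bundle.TotalSpace.mk' E3 (E := fun q : M => TangentSpace (𝓡 3) q) q (U q)) p

theorem SmoothAt.diffAt {U : VField M} {p : M} (h : SmoothAt U p) : DiffAt U p :=
  h.mdifferentiableAt (by simp)

theorem smoothAt_ext {p : M} (u : TangentSpace (𝓡 3) p) : SmoothAt (ext u) p :=
  FiberBundle.contMDiffAt_extend ..

theorem diffAt_ext {p : M} (u : TangentSpace (𝓡 3) p) : DiffAt (ext u) p :=
  FiberBundle.mdifferentiableAt_extend ..

@[simp] theorem ext_self {p : M} (u : TangentSpace (𝓡 3) p) : ext u p = u := by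
  simp [ext]

theorem OneForm.IsSmooth.pair_smoothAt {α : OneForm M} (hα : α.IsSmooth) {U : VField M} {p : M}
    (hU : SmoothAt U p) : ContMDiffAt (𝓡 3) 𝓘(ℝ, ℝ) ∞ (pair α U) p := by
  have h := ContMDiffAt.clm_bundle_apply (E₂ := Bundle.Trivial M ℝ) (F₂ := ℝ) (hα p) hU
  rw [contMDiffAt_totalSpace] at h
  exact h.2

theorem OneForm.IsSmooth.pair_diffAt {α : OneForm M} (hα : α.IsSmooth) {U : VField M} {p : M}
    (hU : DiffAt U p) : MDifferentiableAt (𝓡 3) 𝓘(ℝ, ℝ) (pair α U) p := by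
  have h := MDifferentiableAt.clm_bundle_apply (E₂ := Bundle.Trivial M ℝ) (F₂ := ℝ)
    ((hα p).mdifferentiableAt (by simp)) hU
  rw [mdifferentiableAt_totalSpace] at h
  exact h.2

theorem contMDiffAt_mvfderiv_apply {h : M → ℝ} {U : VField M} {p : M}
    (hh : ContMDiffAt (𝓡 3) 𝓘(ℝ, ℝ) ∞ h p) (hU : SmoothAt U p) :
    ContMDiffAt (𝓡 3) 𝓘(ℝ, ℝ) ∞ (fun q => mvfderiv (𝓡 3) h q (U q)) p := by
  have h1 := ContMDiffAt.mfderiv_const (m := ∞) hh (by simp)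
  have h2 := ContMDiffAt.clm_apply_of_inCoordinates (IB₁ := 𝓡 3) (IB₂ := 𝓘(ℝ, ℝ)) (b₁ := id) (b₂ := h)
    (E₁ := fun q : M => TangentSpace (𝓡 3) q) (E₂ := fun q : ℝ => TangentSpace 𝓘(ℝ, ℝ) q)
     h1 hU hh
  rw [contMDiffAt_totalSpace] at h2
  have h3 := h2.2
  simp only [mfld_simps] at h3
  exact h3

/-- A vector field read in the preferred chart at `p₀`. -/
def chartField (p₀ : M) (U : VField M) : E3 → E3 :=
  mpullback 𝓘(ℝ, E3) (𝓡 3) (extChartAt (𝓡 3) p₀).symm U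

omit [IsManifold (𝓡 3) ∞ M] in
theorem isOpen_chartTarget (p₀ : M) : IsOpen (extChartAt (𝓡 3) p₀).target :=
  isOpen_extChartAt_target p₀

theorem contMDiffAt_chart_symm {p₀ : M} {y : E3} (hy : y ∈ (extChartAt (𝓡 3) p₀).target) :
    ContMDiffAt 𝓘(ℝ, E3) (𝓡 3) ∞ (extChartAt (𝓡 3) p₀).symm y :=
  (contMDiffOn_extChartAt_symm (n := ∞) p₀).contMDiffAt ((isOpen_chartTarget p₀).mem_nhds hy)

theorem isInvertible_mfderiv_chart_symm {p₀ : M} {y : E3}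
    (hy : y ∈ (extChartAt (𝓡 3) p₀).target) :
    (mfderiv 𝓘(ℝ, E3) (𝓡 3) (extChartAt (𝓡 3) p₀).symm y).IsInvertible := by
  have h := isInvertible_mfderivWithin_extChartAt_symm hy
  simpa only [ModelWithCorners.range_eq_univ, mfderivWithin_univ] using h

theorem mfderiv_chart_symm_chartField {p₀ : M} {y : E3} (hy : y ∈ (extChartAt (𝓡 3) p₀).target)
    (U : VField M) :
    mfderiv 𝓘(ℝ, E3) (𝓡 3) (extChartAt (𝓡 3) p₀).symm y (chartField p₀ U y) =
      U ((extChartAt (𝓡 3) p₀).symm y) :=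
  (isInvertible_mfderiv_chart_symm hy).self_apply_inverse _

theorem contDiffAt_chartField {p₀ : M} {y : E3} (hy : y ∈ (extChartAt (𝓡 3) p₀).target)
    {U : VField M} (hU : SmoothAt U ((extChartAt (𝓡 3) p₀).symm y)) :
    ContDiffAt ℝ ∞ (chartField p₀ U) y := by
  have h := ContMDiffAt.mpullback_vectorField_preimage (m := ∞) (n := ∞) hU
    (contMDiffAt_chart_symm hy) (isInvertible_mfderiv_chart_symm hy) (by simp)
  rw [contMDiffAt_totalSpace] at h
  have h2 := h.2
  simp only [mfld_simps] at h2
  exact contMDiffAt_iff_contDiffAt.1 h2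

theorem lieBracket_chartField {p₀ : M} {y : E3} (hy : y ∈ (extChartAt (𝓡 3) p₀).target)
    {U V : VField M} (hU : DiffAt U ((extChartAt (𝓡 3) p₀).symm y))
    (hV : DiffAt V ((extChartAt (𝓡 3) p₀).symm y)) :
    lieBracket ℝ (chartField p₀ U) (chartField p₀ V) y =
      chartField p₀ (mlieBracket (𝓡 3) U V) y := by
  have : IsManifold (𝓡 3) (minSmoothness ℝ 2) M := isManifold_minSmoothness M 2
  have h := mpullback_mlieBracket (n := ∞) hU hV (contMDiffAt_chart_symm hy)
    (by simpa using nat_le_infty 2)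
  rw [← mlieBracketWithin_univ (V := mpullback _ _ _ U), mlieBracketWithin_eq_lieBracketWithin] at h
  exact (h.trans (congrFun lieBracketWithin_univ y)).symm

theorem mvfderiv_chart_symm {p₀ : M} {y : E3} (hy : y ∈ (extChartAt (𝓡 3) p₀).target)
    {h : M → ℝ} (hh : MDifferentiableAt (𝓡 3) 𝓘(ℝ, ℝ) h ((extChartAt (𝓡 3) p₀).symm y))
    (U : VField M) :
    mvfderiv (𝓡 3) h ((extChartAt (𝓡 3) p₀).symm y) (U ((extChartAt (𝓡 3) p₀).symm y)) =
      fderiv ℝ (h ∘ (extChartAt (𝓡 3) p₀).symm) y (chartField p₀ U y) := by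
  rw [← mfderiv_eq_fderiv, mfderiv_comp y hh ((contMDiffAt_chart_symm hy).mdifferentiableAt (by simp)),
    ← mfderiv_chart_symm_chartField hy U]
  rfl

/-- In a chart the iterated derivatives split into a second derivative of `h`, which cancels by
symmetry, and `Dh` applied to derivatives of the fields, which form the bracket. -/
theorem mvfderiv_mlieBracket {h : M → ℝ} {U V : VField M} {p : M}
    (hh : ContMDiffAt (𝓡 3) 𝓘(ℝ, ℝ) ∞ h p) (hU : SmoothAt U p) (hV : SmoothAt V p) :
    mvfderiv (𝓡 3) h p (mlieBracket (𝓡 3) U V p) =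
      mvfderiv (𝓡 3) (fun q => mvfderiv (𝓡 3) h q (V q)) p (U p) -
      mvfderiv (𝓡 3) (fun q => mvfderiv (𝓡 3) h q (U q)) p (V p) := by
  set c := extChartAt (𝓡 3) p with hc
  set y := c p with hy
  have hyt : y ∈ c.target := mem_extChartAt_target p
  have hcy : c.symm y = p := extChartAt_to_inv p
  have hev : ∀ᶠ z in 𝓝 y, MDifferentiableAt (𝓡 3) 𝓘(ℝ, ℝ) h (c.symm z) := by
    have h1 : ∀ᶠ q in 𝓝 (c.symm y), MDifferentiableAt (𝓡 3) 𝓘(ℝ, ℝ) h q := by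
      rw [hcy]
      have h2 : ContMDiffAt (𝓡 3) 𝓘(ℝ, ℝ) 1 h p := hh.of_le (by simp)
      exact ((contMDiffAt_iff_contMDiffAt_nhds (by simp)).1 h2).mono fun q hq => hq.mdifferentiableAt (by simp)
    exact (contMDiffAt_chart_symm hyt).continuousAt.eventually h1
  have hg : ContDiffAt ℝ ∞ (h ∘ c.symm) y := by
    rw [← contMDiffAt_iff_contDiffAt]
    exact ContMDiffAt.comp y (by rw [hcy]; exact hh) (contMDiffAt_chart_symm hyt)
  have key : ∀ W : VField M, (fun q => mvfderiv (𝓡 3) h q (W q)) ∘ c.symm =ᶠ[𝓝 y]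
      fun z => fderiv ℝ (h ∘ c.symm) z (chartField p W z) := by
    intro W
    filter_upwards [hev, (isOpen_chartTarget p).mem_nhds hyt] with z hz hzt
    exact mvfderiv_chart_symm hzt hz W
  have hfd : DifferentiableAt ℝ (fderiv ℝ (h ∘ c.symm)) y :=
    (hg.fderiv_right (m := 1) (by exact_mod_cast nat_le_infty 2)).differentiableAt (by simp)
  have hfield : ∀ W : VField M, SmoothAt W p → DifferentiableAt ℝ (chartField p W) y := by
    intro W hW
    exact (contDiffAt_chartField hyt (by rw [← hc, hcy]; exact hW)).differentiableAt (by simp)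
  have main : ∀ W Z : VField M, SmoothAt W p → SmoothAt Z p →
      mvfderiv (𝓡 3) (fun q => mvfderiv (𝓡 3) h q (W q)) p (Z p) =
      fderiv ℝ (fderiv ℝ (h ∘ c.symm)) y (chartField p Z y) (chartField p W y) +
      fderiv ℝ (h ∘ c.symm) y (fderiv ℝ (chartField p W) y (chartField p Z y)) := by
    intro W Z hW hZ
    have h1 := mvfderiv_chart_symm hyt (h := fun q => mvfderiv (𝓡 3) h q (W q)) (by
      rw [← hc, hcy]
      exact (contMDiffAt_mvfderiv_apply hh hW).mdifferentiableAt (by simp)) Z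
    rw [← hc, hcy] at h1
    rw [h1, (key W).fderiv_eq, fderiv_clm_apply hfd (hfield W hW)]
    simp [add_comm]
  rw [main V U hV hU, main U V hU hV]
  have h1 := mvfderiv_chart_symm hyt (h := h) (by rw [← hc, hcy]; exact hh.mdifferentiableAt (by simp))
    (mlieBracket (𝓡 3) U V)
  rw [← lieBracket_chartField hyt (by rw [← hc, hcy]; exact hU.mdifferentiableAt (by simp))
    (by rw [← hc, hcy]; exact hV.mdifferentiableAt (by simp)), ← hc, hcy] at h1
  rw [h1, lieBracket, map_sub]
  have hs : IsSymmSndFDerivAt ℝ (h ∘ c.symm) y := hg.isSymmSndFDerivAt (by simpa using nat_le_infty 2)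
  rw [hs.eq (chartField p U y)]
  ring

/-- Differentiability of a 1-form at a point, in terms of differentiable vector fields. -/
abbrev MForm (α : OneForm M) (p : M) : Prop :=
  ∀ {U : VField M}, DiffAt U p → MDifferentiableAt (𝓡 3) 𝓘(ℝ, ℝ) (pair α U) p

/-- `Preserves` speaks only of the chosen extensions `ext u`. Tensoriality transfers it to every
differentiable field, as `lieDeriv_eq_zero` records. -/
theorem tensorial_lie {α : OneForm M} (hα : α.IsSmooth) {X : VField M} {p : M} :
    TensorialAt (𝓡 3) E3 (fun U : VField M =>
      mvfderiv (𝓡 3) (pair α U) p (X p) - α p (mlieBracket (𝓡 3) X U p)) p where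
  smul {f U} hf hU := by
    have e : pair α (f • U) = f * pair α U := by ext q; simp [pair]
    rw [e, mvfderiv_mul hf (hα.pair_diffAt hU), mlieBracket_smul_right hf hU]
    simp [pair]; ring
  add {U V} hU hV := by
    have e : pair α (U + V) = pair α U + pair α V := by ext q; simp [pair]
    rw [e, mvfderiv_add (hα.pair_diffAt hU) (hα.pair_diffAt hV), mlieBracket_add_right hU hV]
    simp; ring

theorem lieDeriv_eq_zero {X : VField M} {α : OneForm M} (hα : α.IsSmooth) (h : Preserves X α)
    {U : VField M} {p : M} (hU : DiffAt U p) :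
    mvfderiv (𝓡 3) (pair α U) p (X p) = α p (mlieBracket (𝓡 3) X U p) := by
  have h1 := (tensorial_lie hα (X := X)).pointwise hU (diffAt_ext (U p)) (by simp)
  have h2 := h p (U p)
  rw [lieDerivForm] at h2
  simp only [h2] at h1
  linarith

/-- The exterior derivative evaluated on vector fields. -/
def dField (α : OneForm M) (p : M) (U V : VField M) : ℝ :=
  mvfderiv (𝓡 3) (pair α V) p (U p) - mvfderiv (𝓡 3) (pair α U) p (V p)
    - α p (mlieBracket (𝓡 3) U V p)

omit [IsManifold (𝓡 3) ∞ M] in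
theorem dField_swap (α : OneForm M) (p : M) (U V : VField M) :
    dField α p V U = - dField α p U V := by
  rw [dField, dField, mlieBracket_swap_apply, map_neg]
  ring

/-- The weak hypothesis `MForm` covers `unitForm X` as well as smooth forms: pairings with `unitForm
X` are inner products. -/
theorem tensorial_dField_right {α : OneForm M} {p : M} (hα : MForm α p) {U : VField M} :
    TensorialAt (𝓡 3) E3 (dField α p U) p where
  smul {f V} hf hV := by
    have e : pair α (f • V) = f * pair α V := by ext q; simp [pair]
    rw [dField, dField, e, mvfderiv_mul hf (hα hV), mlieBracket_smul_right hf hV]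
    simp [pair]; ring
  add {V W} hV hW := by
    have e : pair α (V + W) = pair α V + pair α W := by ext q; simp [pair]
    rw [dField, dField, dField, e, mvfderiv_add (hα hV) (hα hW), mlieBracket_add_right hV hW]
    simp; ring

theorem tensorial_dField_left {α : OneForm M} {p : M} (hα : MForm α p) {V : VField M} :
    TensorialAt (𝓡 3) E3 (fun U => dField α p U V) p where
  smul {f U} hf hU := by
    rw [dField_swap, (tensorial_dField_right hα).smul hf hU, dField_swap]; simp
  add {U W} hU hW := by
    rw [dField_swap, (tensorial_dField_right hα).add hU hW, dField_swap α p V U,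
      dField_swap α p V W]; ring

theorem dForm_eq_dField (α : OneForm M) (p : M) (u v : TangentSpace (𝓡 3) p) :
    dForm α p u v = dField α p (ext u) (ext v) := by
  simp [dForm, dField]

theorem dForm_apply {α : OneForm M} {p : M} (hα : MForm α p) {U V : VField M}
    (hU : DiffAt U p) (hV : DiffAt V p) : dForm α p (U p) (V p) = dField α p U V := by
  rw [dForm_eq_dField]
  exact TensorialAt.pointwise₂ (fun _ _ => tensorial_dField_left hα)
    (fun _ _ => tensorial_dField_right hα)
    (diffAt_ext _) hU (diffAt_ext _) hV (by simp) (by simp)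

/-- The exterior derivative as a bilinear form. -/
theorem exists_bilin_dForm {α : OneForm M} {p : M} (hα : MForm α p) :
    ∃ B : TangentSpace (𝓡 3) p →ₗ[ℝ] TangentSpace (𝓡 3) p →ₗ[ℝ] ℝ,
      (∀ u v, dForm α p u v = B u v) ∧ ∀ u, B u u = 0 := by
  let C := TensorialAt.mkHom₂ (I := 𝓡 3) (F := E3) (F' := E3) (dField α p) p
    (fun _ _ => tensorial_dField_left hα) (fun _ _ => tensorial_dField_right hα)
  have hC : ∀ u v, dForm α p u v = C u v := dForm_eq_dField α p
  refine ⟨LinearMap.mk₂ ℝ (fun u v => C u v) (by simp) (by simp) (by simp) (by simp),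
    fun u v => hC u v, fun u => ?_⟩
  have h1 := dField_swap α p (ext u) (ext u)
  have h2 : C u u = dField α p (ext u) (ext u) := (hC u u ▸ dForm_eq_dField α p u u)
  simp only [LinearMap.mk₂_apply]
  linarith

end Calculus

/-! ### The Hodge star and traces in orthonormal bases. -/

section LinearAlgebra

variable {V : Type*} [NormedAddCommGroup V] [InnerProductSpace ℝ V]

/-- The components of a 2-form transform by the cofactors of the change of basis matrix `P`. For
orthogonal `P` the adjugate is `det P` times the transpose, so `ε = det P`. The sign depends on the
basis but not on the form. -/
theorem exists_sign_hodgeStar (hV : Module.finrank ℝ V = 3) (o : Orientation ℝ V (Fin 3))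
    (e : OrthonormalBasis (Fin 3) ℝ V) :
    ∃ ε : ℝ, ε * ε = 1 ∧ ∀ B : V →ₗ[ℝ] V →ₗ[ℝ] ℝ, (∀ u, B u u = 0) →
      hodgeStar hV o (fun u v => B u v) (e 0) = ε * B (e 1) (e 2) ∧
      hodgeStar hV o (fun u v => B u v) (e 1) = ε * B (e 2) (e 0) ∧
      hodgeStar hV o (fun u v => B u v) (e 2) = ε * B (e 0) (e 1) := by
  set b := o.finOrthonormalBasis (by norm_num) hV with hb
  let P : Matrix (Fin 3) (Fin 3) ℝ := fun i j => inner ℝ (b i) (e j)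
  have hP : P.transpose * P = 1 := by
    ext i j
    rw [Matrix.mul_apply, Matrix.one_apply]
    have := b.sum_inner_mul_inner (e i) (e j)
    rw [orthonormal_iff_ite.1 e.orthonormal i j] at this
    rw [← this]
    refine Finset.sum_congr rfl fun k _ => ?_
    change inner ℝ (b k) (e i) * inner ℝ (b k) (e j) = _
    rw [real_inner_comm]
  have hdet : P.det * P.det = 1 := by
    have := congrArg Matrix.det hP
    rwa [Matrix.det_mul, Matrix.det_transpose, Matrix.det_one] at this
  have hadj : P.adjugate = P.det • P.transpose := by
    calc P.adjugate = (P.transpose * P) * P.adjugate := by rw [hP, one_mul]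
      _ = P.transpose * (P * P.adjugate) := by rw [mul_assoc]
      _ = P.det • P.transpose := by rw [Matrix.mul_adjugate]; simp
  have hc : ∀ i j, P.adjugate i j = P.det * P j i := fun i j => by rw [hadj]; simp
  rw [Matrix.adjugate_fin_three] at hc
  refine ⟨P.det, hdet, fun B hB => ?_⟩
  have hsw : ∀ u v, B u v = - B v u := by
    intro u v
    have := hB (u + v)
    simp only [map_add, LinearMap.add_apply, hB] at this
    linarith
  have he : ∀ j, e j = P 0 j • b 0 + P 1 j • b 1 + P 2 j • b 2 := by
    intro j
    rw [← b.sum_repr' (e j), Fin.sum_univ_three]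
  have expand : ∀ j k, B (e j) (e k) =
      (P 1 j * P 2 k - P 2 j * P 1 k) * B (b 1) (b 2) +
      (P 2 j * P 0 k - P 0 j * P 2 k) * B (b 2) (b 0) +
      (P 0 j * P 1 k - P 1 j * P 0 k) * B (b 0) (b 1) := by
    intro j k
    rw [he j, he k]
    simp only [map_add, map_smul, LinearMap.add_apply, LinearMap.smul_apply, smul_eq_mul, hB]
    rw [hsw (b 2) (b 1), hsw (b 0) (b 2), hsw (b 1) (b 0)]
    ring
  have star : ∀ j, hodgeStar hV o (fun u v => B u v) (e j) =
      B (b 1) (b 2) * P 0 j + B (b 2) (b 0) * P 1 j + B (b 0) (b 1) * P 2 j := fun j => rfl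
  simp only [star, expand]
  have h := fun i j => congrArg (P.det * ·) (hc i j)
  simp only [← mul_assoc, hdet, one_mul] at h
  have h00 := h 0 0; have h01 := h 0 1; have h02 := h 0 2
  have h10 := h 1 0; have h11 := h 1 1; have h12 := h 1 2
  have h20 := h 2 0; have h21 := h 2 1; have h22 := h 2 2
  simp at h00 h01 h02 h10 h11 h12 h20 h21 h22
  set β₀ := B (b 1) (b 2)
  set β₁ := B (b 2) (b 0)
  set β₂ := B (b 0) (b 1)
  refine ⟨?_, ?_, ?_⟩
  · linear_combination -β₀ * h00 - β₁ * h01 - β₂ * h02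
  · linear_combination -β₀ * h10 - β₁ * h11 - β₂ * h12
  · linear_combination -β₀ * h20 - β₁ * h21 - β₂ * h22

/-- Allows the Laplacian, defined with `stdOrthonormalBasis`, to be computed in a frame adapted to
`X`. -/
theorem sum_bilin_orthonormal {ι κ : Type*} [Fintype ι] [Fintype κ]
    (B : V →ₗ[ℝ] V →ₗ[ℝ] ℝ) (b : OrthonormalBasis ι ℝ V) (e : OrthonormalBasis κ ℝ V) :
    ∑ i, B (b i) (b i) = ∑ k, B (e k) (e k) := by
  classical
  have h1 : ∀ i, B (b i) (b i) =
      ∑ k, ∑ l, (inner ℝ (e k) (b i) * inner ℝ (b i) (e l)) * B (e k) (e l) := by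
    intro i
    conv_lhs => rw [← e.sum_repr' (b i)]
    simp only [map_sum, LinearMap.sum_apply, map_smul, LinearMap.smul_apply, smul_eq_mul,
      Finset.mul_sum]
    rw [Finset.sum_comm]
    refine Finset.sum_congr rfl fun k _ => Finset.sum_congr rfl fun l _ => ?_
    rw [real_inner_comm (b i) (e l)]
    ring
  simp only [h1]
  rw [Finset.sum_comm]
  refine Finset.sum_congr rfl fun k _ => ?_
  rw [Finset.sum_comm, Finset.sum_eq_single k]
  · rw [← Finset.sum_mul, b.sum_inner_mul_inner, orthonormal_iff_ite.1 e.orthonormal]; simp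
  · intro l _ hl
    rw [← Finset.sum_mul, b.sum_inner_mul_inner, orthonormal_iff_ite.1 e.orthonormal]
    simp [hl.symm]
  · simp

end LinearAlgebra

/-! ### Smooth orthonormal frames. -/

section Metric

variable {M : Type*} [TopologicalSpace M] [ChartedSpace E3 M] [IsManifold (𝓡 3) ∞ M]
  [RiemannianBundle (fun p : M => TangentSpace (𝓡 3) p)]
  [IsContMDiffRiemannianBundle (𝓡 3) ∞ E3 (fun p : M => TangentSpace (𝓡 3) p)]

theorem metric_smoothAt {U V : VField M} {p : M} (hU : SmoothAt U p) (hV : SmoothAt V p) :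
    ContMDiffAt (𝓡 3) 𝓘(ℝ, ℝ) ∞ (metric U V) p :=
  ContMDiffAt.inner_bundle hU hV

theorem metric_diffAt {U V : VField M} {p : M} (hU : DiffAt U p) (hV : DiffAt V p) :
    MDifferentiableAt (𝓡 3) 𝓘(ℝ, ℝ) (metric U V) p :=
  haveI : IsContMDiffRiemannianBundle (𝓡 3) 1 E3 (fun p : M => TangentSpace (𝓡 3) p) :=
    IsContMDiffRiemannianBundle.of_le (n := ∞) (by simp)
  MDifferentiableAt.inner_bundle hU hV

theorem SmoothAt.smul {U : VField M} {h : M → ℝ} {p : M}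
    (hh : ContMDiffAt (𝓡 3) 𝓘(ℝ, ℝ) ∞ h p) (hU : SmoothAt U p) :
    SmoothAt (fun q => h q • U q) p :=
  ContMDiffAt.smul_section hh hU

theorem SmoothAt.sub {U V : VField M} {p : M} (hU : SmoothAt U p) (hV : SmoothAt V p) :
    SmoothAt (fun q => U q - V q) p :=
  ContMDiffAt.sub_section hU hV

theorem SmoothAt.sum {ι : Type*} {s : Finset ι} {U : ι → VField M} {p : M}
    (hU : ∀ i ∈ s, SmoothAt (U i) p) : SmoothAt (fun q => ∑ i ∈ s, U i q) p :=
  ContMDiffAt.sum_section hU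

theorem SmoothAt.congr {U V : VField M} {p : M} (hU : SmoothAt U p)
    (h : ∀ᶠ q in 𝓝 p, V q = U q) : SmoothAt V p :=
  ContMDiffAt.congr_of_eventuallyEq hU (h.mono fun q hq => by simp [hq])

theorem norm_eq_sqrt_metric (U : VField M) (q : M) : ‖U q‖ = Real.sqrt (metric U U q) := by
  rw [metric, real_inner_self_eq_norm_sq, Real.sqrt_sq (norm_nonneg _)]

theorem norm_smoothAt {U : VField M} {p : M} (hU : SmoothAt U p) (h0 : U p ≠ 0) :
    ContMDiffAt (𝓡 3) 𝓘(ℝ, ℝ) ∞ (fun q => ‖U q‖) p := by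
  simp only [norm_eq_sqrt_metric]
  have h1 : metric U U p ≠ 0 := by simpa [metric] using h0
  exact (Real.contDiffAt_sqrt h1).contMDiffAt.comp p (metric_smoothAt hU hU)

theorem SmoothAt.eventually_ne {U : VField M} {p : M} (hU : SmoothAt U p) (h0 : U p ≠ 0) :
    ∀ᶠ q in 𝓝 p, U q ≠ 0 := by
  have h := (norm_smoothAt hU h0).continuousAt.eventually_ne (norm_ne_zero_iff.2 h0)
  exact h.mono fun q hq => norm_ne_zero_iff.1 hq

theorem unitField_smoothAt {U : VField M} {p : M} (hU : SmoothAt U p) (h0 : U p ≠ 0) :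
    SmoothAt (unitField U) p := by
  refine SmoothAt.smul ?_ hU
  exact (contDiffAt_inv ℝ (norm_ne_zero_iff.2 h0)).contMDiffAt.comp p (norm_smoothAt hU h0)

theorem norm_unitField {U : VField M} {q : M} (h : U q ≠ 0) : ‖unitField U q‖ = 1 := by
  rw [unitField, norm_smul, norm_inv, norm_norm, inv_mul_cancel₀ (norm_ne_zero_iff.2 h)]

/-- A smooth orthonormal frame near `p`. -/
structure IsONFrame (e : Fin 3 → VField M) (p : M) : Prop where
  smooth : ∀ i, SmoothAt (e i) p
  orthonormal : ∀ᶠ q in 𝓝 p, Orthonormal ℝ (fun i => e i q)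

theorem exists_orthonormalBasis_eq {q : M} {v : Fin 3 → TangentSpace (𝓡 3) q}
    (hv : Orthonormal ℝ v) :
    ∃ b : OrthonormalBasis (Fin 3) ℝ (TangentSpace (𝓡 3) q), ∀ i, b i = v i := by
  obtain ⟨b, hb⟩ := Orthonormal.exists_orthonormalBasis_extension_of_card_eq
    (𝕜 := ℝ) (E := TangentSpace (𝓡 3) q) (ι := Fin 3) (by rw [finrank_tangentSpace]; simp)
    (v := v) (s := univ) (hv.comp _ Subtype.val_injective)
  exact ⟨b, fun i => hb i (mem_univ i)⟩

/-- Gram–Schmidt applied to `X` and two extended vectors. At `p` these vectors already complete `X p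
/ ‖X p‖` to an orthonormal basis, so the projected fields `W1`, `W2` are nonzero at `p`, hence
nearby. -/
theorem exists_onFrame {X : VField M} {p : M} (hX : SmoothAt X p) (h0 : X p ≠ 0) :
    ∃ e : Fin 3 → VField M, IsONFrame e p ∧ e 0 = unitField X := by
  have hE0 := unitField_smoothAt hX h0
  obtain ⟨b, hb⟩ := Orthonormal.exists_orthonormalBasis_extension_of_card_eq
    (𝕜 := ℝ) (E := TangentSpace (𝓡 3) p) (ι := Fin 3) (by rw [finrank_tangentSpace]; simp)
    (v := fun _ => unitField X p) (s := {0}) (by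
      refine ⟨fun _ => norm_unitField h0, fun i j hij => ?_⟩
      exact absurd (Subsingleton.elim i j) hij)
  have hb0 : b 0 = unitField X p := hb 0 rfl
  have hon := orthonormal_iff_ite.1 b.orthonormal
  set E0 := unitField X
  let W1 : VField M := fun q => ext (b 1) q - metric E0 (ext (b 1)) q • E0 q
  have hW1 : SmoothAt W1 p :=
    (smoothAt_ext _).sub (SmoothAt.smul (metric_smoothAt hE0 (smoothAt_ext _)) hE0)
  have hW1p : W1 p = b 1 := by
    simp only [W1, metric, ext_self, ← hb0, hon]; simp
  have hW10 : W1 p ≠ 0 := by rw [hW1p]; exact b.orthonormal.ne_zero 1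
  set E1 := unitField W1 with hE1d
  have hE1 : SmoothAt E1 p := unitField_smoothAt hW1 hW10
  have hE1p : E1 p = b 1 := by
    rw [hE1d, unitField, hW1p, b.orthonormal.1 1]; simp
  let W2 : VField M := fun q => ext (b 2) q - metric E0 (ext (b 2)) q • E0 q
    - metric E1 (ext (b 2)) q • E1 q
  have hW2 : SmoothAt W2 p :=
    ((smoothAt_ext _).sub (SmoothAt.smul (metric_smoothAt hE0 (smoothAt_ext _)) hE0)).sub
      (SmoothAt.smul (metric_smoothAt hE1 (smoothAt_ext _)) hE1)
  have hW2p : W2 p = b 2 := by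
    simp only [W2, metric, ext_self, hE1p, ← hb0, hon]; simp
  have hW20 : W2 p ≠ 0 := by rw [hW2p]; exact b.orthonormal.ne_zero 2
  set E2 := unitField W2 with hE2d
  have hE2 : SmoothAt E2 p := unitField_smoothAt hW2 hW20
  refine ⟨![E0, E1, E2], ⟨fun i => ?_, ?_⟩, rfl⟩
  · fin_cases i
    exacts [hE0, hE1, hE2]
  · filter_upwards [hX.eventually_ne h0, hW1.eventually_ne hW10, hW2.eventually_ne hW20]
      with q h0q h1q h2q
    have n0 : ‖E0 q‖ = 1 := norm_unitField h0q
    have n1 : ‖E1 q‖ = 1 := norm_unitField h1q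
    have n2 : ‖E2 q‖ = 1 := norm_unitField h2q
    have i00 : inner ℝ (E0 q) (E0 q) = (1 : ℝ) := by rw [real_inner_self_eq_norm_sq, n0]; simp
    have i11 : inner ℝ (E1 q) (E1 q) = (1 : ℝ) := by rw [real_inner_self_eq_norm_sq, n1]; simp
    have i01 : inner ℝ (E0 q) (E1 q) = (0 : ℝ) := by
      simp only [hE1d, unitField, W1, inner_smul_right, inner_sub_right, metric, i00]; simp
    have i02 : inner ℝ (E0 q) (E2 q) = (0 : ℝ) := by
      simp only [hE2d, unitField, W2, inner_smul_right, inner_sub_right, metric, i00, i01]; simp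
    have i10 : inner ℝ (E1 q) (E0 q) = (0 : ℝ) := by rw [real_inner_comm, i01]
    have i12 : inner ℝ (E1 q) (E2 q) = (0 : ℝ) := by
      simp only [hE2d, unitField, W2, inner_smul_right, inner_sub_right, metric, i11, i10]; simp
    have i20 : inner ℝ (E2 q) (E0 q) = (0 : ℝ) := by rw [real_inner_comm, i02]
    have i21 : inner ℝ (E2 q) (E1 q) = (0 : ℝ) := by rw [real_inner_comm, i12]
    refine ⟨fun i => ?_, fun i j hij => ?_⟩
    · fin_cases i
      exacts [n0, n1, n2]
    · fin_cases i <;> fin_cases j <;> first | exact absurd rfl hij | assumption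

theorem inner_grad (f : M → ℝ) (q : M) (u : TangentSpace (𝓡 3) q) :
    inner ℝ (grad f q) u = mvfderiv (𝓡 3) f q u := by
  haveI : CompleteSpace (TangentSpace (𝓡 3) q) := FiniteDimensional.complete ℝ _
  exact InnerProductSpace.toDual_symm_apply

theorem IsONFrame.smoothAt_of_inner {e : Fin 3 → VField M} {p : M} (he : IsONFrame e p)
    {G : VField M} (hG : ∀ i, ContMDiffAt (𝓡 3) 𝓘(ℝ, ℝ) ∞ (metric (e i) G) p) : SmoothAt G p := by
  refine SmoothAt.congr (U := fun q => ∑ i, metric (e i) G q • e i q) ?_ ?_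
  · exact SmoothAt.sum fun i _ => SmoothAt.smul (hG i) (he.smooth i)
  · filter_upwards [he.orthonormal] with q hq
    obtain ⟨b, hb⟩ := exists_orthonormalBasis_eq hq
    rw [← b.sum_repr' (G q)]
    simp [hb, metric]

theorem exists_onFrame_at (p : M) : ∃ e : Fin 3 → VField M, IsONFrame e p := by
  haveI : Nontrivial (TangentSpace (𝓡 3) p) :=
    Module.nontrivial_of_finrank_pos (R := ℝ) (by rw [finrank_tangentSpace]; norm_num)
  obtain ⟨u, hu⟩ := exists_ne (0 : TangentSpace (𝓡 3) p)
  obtain ⟨e, he, -⟩ := exists_onFrame (smoothAt_ext u) (by rwa [ext_self])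
  exact ⟨e, he⟩

end Metric

/-! ### The Hessian as half the Lie derivative of the metric. -/

section Hessian

variable {M : Type*} [TopologicalSpace M] [ChartedSpace E3 M] [IsManifold (𝓡 3) ∞ M]
  [RiemannianBundle (fun p : M => TangentSpace (𝓡 3) p)]
  [IsContMDiffRiemannianBundle (𝓡 3) ∞ E3 (fun p : M => TangentSpace (𝓡 3) p)]

omit [IsManifold (𝓡 3) ∞ M] [RiemannianBundle (fun p : M => TangentSpace (𝓡 3) p)]
  [IsContMDiffRiemannianBundle (𝓡 3) ∞ E3 (fun p : M => TangentSpace (𝓡 3) p)] in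
theorem mvfderiv_congr {f g : M → ℝ} {p : M} (h : f =ᶠ[𝓝 p] g) :
    mvfderiv (𝓡 3) f p = mvfderiv (𝓡 3) g p :=
  h.mfderiv_eq

/-- The Hessian form `(L_G g)(U, V) / 2` of a gradient field `G`. -/
def hessField (G : VField M) (p : M) (U V : VField M) : ℝ :=
  (1 / 2) * (mvfderiv (𝓡 3) (metric U V) p (G p) + inner ℝ (mlieBracket (𝓡 3) U G p) (V p)
    + inner ℝ (U p) (mlieBracket (𝓡 3) V G p))

theorem metric_comm (U V : VField M) : metric U V = metric V U := by
  ext q; simp only [metric]; exact real_inner_comm _ _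

theorem hessField_comm (G : VField M) (p : M) (U V : VField M) :
    hessField G p U V = hessField G p V U := by
  simp only [hessField, metric_comm U V]
  rw [real_inner_comm (V p), real_inner_comm (U p)]
  ring

theorem metric_grad_left (f : M → ℝ) (Z : VField M) :
    metric (grad f) Z = fun q => mvfderiv (𝓡 3) f q (Z q) := by
  ext q; exact inner_grad f q (Z q)

/-- With `Y = ∇f`, three Koszul terms are `U(Zf)`, `-Z(Uf)` and `-[U, Z]f`, whose sum vanishes. What
remains is symmetric in `U, Z` and tensorial. -/
theorem koszul_grad {f : M → ℝ} {p : M} (hf : ContMDiffAt (𝓡 3) 𝓘(ℝ, ℝ) ∞ f p) {U Z : VField M}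
    (hU : SmoothAt U p) (hZ : SmoothAt Z p) :
    koszul U (grad f) Z p = hessField (grad f) p U Z := by
  have h := mvfderiv_mlieBracket hf hU hZ
  rw [koszul, hessField, metric_comm U (grad f), metric_grad_left, metric_grad_left,
    real_inner_comm (grad f p), inner_grad, h, mlieBracket_swap_apply (V := grad f) (W := Z),
    inner_neg_left, real_inner_comm (U p)]
  ring

theorem tensorial_hessField_left {G : VField M} {p : M} {V : VField M} (hV : DiffAt V p) :
    TensorialAt (𝓡 3) E3 (fun U => hessField G p U V) p where
  smul {h U} hh hU := by
    have e : metric (h • U) V = h * metric U V := by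
      ext q; simp [metric, inner_smul_left]
    simp only [hessField]
    rw [e, mvfderiv_mul hh (metric_diffAt hU hV), mlieBracket_smul_left hh hU]
    simp [metric, inner_smul_left, inner_add_left]; ring
  add {U W} hU hW := by
    have e : metric (U + W) V = metric U V + metric W V := by
      ext q; simp [metric, inner_add_left]
    simp only [hessField]
    rw [e, mvfderiv_add (metric_diffAt hU hV) (metric_diffAt hW hV), mlieBracket_add_left hU hW]
    simp [inner_add_left]; ring

theorem tensorial_hessField_right {G : VField M} {p : M} {U : VField M} (hU : DiffAt U p) :
    TensorialAt (𝓡 3) E3 (hessField G p U) p := by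
  have : hessField G p U = fun V => hessField G p V U := by
    ext V; exact hessField_comm _ _ _ _
  rw [this]
  exact tensorial_hessField_left hU

/-- Removes the choices of basis and extensions built into `leviCivita`: the Hessian may be
evaluated on any differentiable fields with the given values. -/
theorem exists_bilin_hess {f : M → ℝ} {p : M} (hf : ContMDiffAt (𝓡 3) 𝓘(ℝ, ℝ) ∞ f p) :
    ∃ B : TangentSpace (𝓡 3) p →ₗ[ℝ] TangentSpace (𝓡 3) p →ₗ[ℝ] ℝ,
      (∀ u v, hess f p u v = B u v) ∧
      ∀ U V : VField M, DiffAt U p → DiffAt V p → B (U p) (V p) = hessField (grad f) p U V := by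
  let C := TensorialAt.mkHom₂ (I := 𝓡 3) (F := E3) (F' := E3) (hessField (grad f) p) p
    (fun _ h => tensorial_hessField_left h) (fun _ h => tensorial_hessField_right h)
  refine ⟨LinearMap.mk₂ ℝ (fun u v => C u v) (by simp) (by simp) (by simp) (by simp),
    fun u v => ?_, fun U V hU hV => ?_⟩
  · have h1 : ∀ w, koszul (ext u) (grad f) (ext w) p = C u w := fun w =>
      koszul_grad hf (smoothAt_ext u) (smoothAt_ext w)
    simp only [hess, leviCivita, h1, sum_inner, inner_smul_left, LinearMap.mk₂_apply]
    conv_rhs => rw [← (stdOrthonormalBasis ℝ (TangentSpace (𝓡 3) p)).sum_repr' v, map_sum]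
    refine Finset.sum_congr rfl fun i _ => ?_
    rw [map_smul, smul_eq_mul, mul_comm]
    rfl
  · exact TensorialAt.pointwise₂ (fun _ h => tensorial_hessField_left h)
      (fun _ h => tensorial_hessField_right h) (diffAt_ext _) hU (diffAt_ext _) hV
      (by simp) (by simp)

theorem hess_unit {f : M → ℝ} {p : M} (hf : ContMDiffAt (𝓡 3) 𝓘(ℝ, ℝ) ∞ f p) {U : VField M}
    (hU : SmoothAt U p) (h1 : ∀ᶠ q in 𝓝 p, metric U U q = 1) :
    hess f p (U p) (U p) = - inner ℝ (mlieBracket (𝓡 3) (grad f) U p) (U p) := by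
  obtain ⟨B, hB, hB2⟩ := exists_bilin_hess hf
  rw [hB, hB2 U U hU.diffAt hU.diffAt, hessField, real_inner_comm _ (U p),
    mlieBracket_swap_apply, inner_neg_left, mvfderiv_congr h1, mvfderiv_const]
  simp
  ring

end Hessian

/-! ### Cartan's formula and the structure equation of an adapted metric. -/

section Equation

variable {M : Type*} [TopologicalSpace M] [ChartedSpace E3 M] [IsManifold (𝓡 3) ∞ M]

theorem SmoothAt.mlieBracket {U V : VField M} {p : M} (hU : SmoothAt U p) (hV : SmoothAt V p) :
    SmoothAt (mlieBracket (𝓡 3) U V) p := by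
  have : IsManifold (𝓡 3) ((⊤ : ℕ∞) + 1) M := ‹IsManifold (𝓡 3) ∞ M›
  have : IsManifold (𝓡 3) (minSmoothness ℝ 2) M := isManifold_minSmoothness M 2
  exact ContMDiffAt.mlieBracket_vectorField (m := ⊤) (n := ⊤) hU hV
    (by rw [minSmoothness_of_isRCLikeNormedField]; exact le_rfl)

theorem SmoothAt.eventually_diffAt {U : VField M} {p : M} (hU : SmoothAt U p) :
    ∀ᶠ q in 𝓝 p, DiffAt U q := by
  have : IsManifold (𝓡 3) 1 M := IsManifold.of_le (n := ∞) (by simp)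
  have h1 : ContMDiffAt (𝓡 3) ((𝓡 3).prod 𝓘(ℝ, E3)) 1
    (fun q => Bundle.TotalSpace.mk' E3 (E := fun q : M => TangentSpace (𝓡 3) q) q (U q)) p :=
    hU.of_le (by simp)
  exact ((contMDiffAt_iff_contMDiffAt_nhds (by simp)).1 h1).mono
    fun q hq => hq.mdifferentiableAt (by simp)

theorem dForm_smoothAt {α : OneForm M} (hα : α.IsSmooth) {U V : VField M} {p : M}
    (hU : SmoothAt U p) (hV : SmoothAt V p) :
    ContMDiffAt (𝓡 3) 𝓘(ℝ, ℝ) ∞ (fun q => dForm α q (U q) (V q)) p := by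
  have h1 := (contMDiffAt_mvfderiv_apply (hα.pair_smoothAt hV) hU).sub
    (contMDiffAt_mvfderiv_apply (hα.pair_smoothAt hU) hV)
  have h2 := h1.sub (hα.pair_smoothAt (hU.mlieBracket hV))
  refine h2.congr_of_eventuallyEq ?_
  filter_upwards [hU.eventually_diffAt, hV.eventually_diffAt] with q hUq hVq
  exact dForm_apply (fun hW => hα.pair_diffAt hW) hUq hVq

/-- Cartan's formula `L_X α = d(α(X)) + ι_X dα` with vanishing left side. -/
theorem mvfderiv_eq_neg_dForm {α : OneForm M} (hα : α.IsSmooth) {X : VField M} {p : M}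
    (hX : DiffAt X p) (h : Preserves X α) (u : TangentSpace (𝓡 3) p) :
    mvfderiv (𝓡 3) (pair α X) p u = - dForm α p (X p) u := by
  have h1 := dForm_apply (fun hW => hα.pair_diffAt hW) hX (diffAt_ext u)
  have h2 := lieDeriv_eq_zero hα h (diffAt_ext u)
  rw [ext_self, dField, h2, ext_self] at h1
  rw [h1]; ring

theorem IsContactForm.ne_zero {α : OneForm M} (hα : IsContactForm α) (p : M) : α p ≠ 0 := by
  intro h
  obtain ⟨u, v, w, h1⟩ := hα.nonintegrable p
  simp [h] at h1

variable [RiemannianBundle (fun p : M => TangentSpace (𝓡 3) p)]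
  [IsContMDiffRiemannianBundle (𝓡 3) ∞ E3 (fun p : M => TangentSpace (𝓡 3) p)]

/-- The factor is `m = ε μ`, with `ε = ±1` the sign of the frame relative to `o`. The last clause
holds because the same sign enters the star of every 2-form; it brings `ℰ` into the same terms as
`dα`. -/
theorem exists_signed_factor {o : (p : M) → Orientation ℝ (TangentSpace (𝓡 3) p) (Fin 3)}
    {α : OneForm M} (hα : IsContactForm α) {μ : M → ℝ} (hμ : IsAdapted o α μ)
    {e : Fin 3 → VField M} {p : M} (he : IsONFrame e p) :
    ∃ m : M → ℝ, ContMDiffAt (𝓡 3) 𝓘(ℝ, ℝ) ∞ m p ∧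
      (∀ᶠ q in 𝓝 p, |m q| = |μ q| ∧
        ∀ i : Fin 3, dForm α q (e (i + 1) q) (e (i + 2) q) = m q * α q (e i q)) ∧
      ∀ B : TangentSpace (𝓡 3) p →ₗ[ℝ] TangentSpace (𝓡 3) p →ₗ[ℝ] ℝ, (∀ u, B u u = 0) →
        μ p * hodgeStar (finrank_tangentSpace p) (o p) (fun u v => B u v) (e 0 p) =
          m p * B (e 1 p) (e 2 p) := by
  have key : ∀ q, ∃ m : ℝ, Orthonormal ℝ (fun i => e i q) → |m| = |μ q| ∧
      (∀ i : Fin 3, dForm α q (e (i + 1) q) (e (i + 2) q) = m * α q (e i q)) ∧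
      ∀ B : TangentSpace (𝓡 3) q →ₗ[ℝ] TangentSpace (𝓡 3) q →ₗ[ℝ] ℝ, (∀ u, B u u = 0) →
        μ q * hodgeStar (finrank_tangentSpace q) (o q) (fun u v => B u v) (e 0 q) =
          m * B (e 1 q) (e 2 q) := by
    intro q
    by_cases hq : Orthonormal ℝ (fun i => e i q)
    · obtain ⟨b, hb⟩ := exists_orthonormalBasis_eq hq
      obtain ⟨ε, hε, h⟩ := exists_sign_hodgeStar (finrank_tangentSpace q) (o q) b
      simp only [hb] at h
      refine ⟨ε * μ q, fun _ => ⟨?_, fun i => ?_, fun B hB => ?_⟩⟩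
      · have : |ε| = 1 := by
          have := abs_mul_abs_self ε
          nlinarith [abs_nonneg ε]
        rw [abs_mul, this, one_mul]
      · obtain ⟨B, hB, hB0⟩ := exists_bilin_dForm (α := α) (p := q)
          (fun hW => hα.smooth.pair_diffAt hW)
        have hd : dForm α q = fun u v => B u v := by ext u v; exact hB u v
        obtain ⟨h0, h1, h2⟩ := h B hB0
        rw [← hd, hμ.beltrami] at h0 h1 h2
        simp only [hB]
        fin_cases i
        · show B (e 1 q) (e 2 q) = ε * μ q * α q (e 0 q)
          linear_combination -ε * h0 - B (e 1 q) (e 2 q) * hε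
        · show B (e 2 q) (e 0 q) = ε * μ q * α q (e 1 q)
          linear_combination -ε * h1 - B (e 2 q) (e 0 q) * hε
        · show B (e 0 q) (e 1 q) = ε * μ q * α q (e 2 q)
          linear_combination -ε * h2 - B (e 0 q) (e 1 q) * hε
      · rw [(h B hB).1]; ring
    -- An arbitrary value where the frame is not orthonormal; this does not happen near `p`.
    · exact ⟨0, fun h => absurd h hq⟩
  choose m hm using key
  refine ⟨m, ?_, he.orthonormal.mono fun q hq => ⟨(hm q hq).1, (hm q hq).2.1⟩,
    fun B hB => (hm p he.orthonormal.self_of_nhds).2.2 B hB⟩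
  -- Smoothness of `m` does not need continuity of the sign: near `p`, `m` is the quotient of `dα(e
  -- (i+1), e (i+2))` by `α(e i)` for an `i` with nonzero denominator.
  obtain ⟨i, hi⟩ : ∃ i, α p (e i p) ≠ 0 := by
    by_contra! h0
    refine hα.ne_zero p ?_
    obtain ⟨b, hb⟩ := exists_orthonormalBasis_eq he.orthonormal.self_of_nhds
    ext u
    rw [← b.sum_repr' u]
    simp [hb, h0]
  have hai := hα.smooth.pair_smoothAt (he.smooth i)
  have hdi := dForm_smoothAt hα.smooth (he.smooth (i + 1)) (he.smooth (i + 2))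
  refine (hdi.mul ((contDiffAt_inv ℝ hi).contMDiffAt.comp p hai)).congr_of_eventuallyEq ?_
  filter_upwards [he.orthonormal, hai.continuousAt.eventually_ne hi] with q hq hq2
  have := (hm q hq).2.1 i
  simp only [Pi.mul_apply, Function.comp_apply, this]
  have hq3 : α q (e i q) ≠ 0 := hq2
  simp only [pair]
  field_simp

end Equation

/-! ### The subelliptic equation. -/

section Subelliptic

variable {M : Type*} [TopologicalSpace M] [ChartedSpace E3 M] [IsManifold (𝓡 3) ∞ M]
  [RiemannianBundle (fun p : M => TangentSpace (𝓡 3) p)]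
  [IsContMDiffRiemannianBundle (𝓡 3) ∞ E3 (fun p : M => TangentSpace (𝓡 3) p)]

theorem VField.IsSmooth.smoothAt {X : VField M} (hX : X.IsSmooth) (p : M) : SmoothAt X p := hX p

theorem Orthonormal.sum_frame {q : M} {e : Fin 3 → VField M}
    (h : Orthonormal ℝ (fun i => e i q)) (u : TangentSpace (𝓡 3) q) :
    u = inner ℝ (e 0 q) u • e 0 q + inner ℝ (e 1 q) u • e 1 q + inner ℝ (e 2 q) u • e 2 q := by
  obtain ⟨b, hb⟩ := exists_orthonormalBasis_eq h
  conv_lhs => rw [← b.sum_repr' u, Fin.sum_univ_three]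
  simp only [hb]

theorem mvfderiv_log {ρ : M → ℝ} {p : M} (hρ : MDifferentiableAt (𝓡 3) 𝓘(ℝ, ℝ) ρ p)
    (h0 : ρ p ≠ 0) (u : TangentSpace (𝓡 3) p) :
    mvfderiv (𝓡 3) (fun q => Real.log (ρ q)) p u = (ρ p)⁻¹ * mvfderiv (𝓡 3) ρ p u := by
  have h1 := mvfderiv_comp_apply p
    ((Real.differentiableAt_log h0).mdifferentiableAt (E := ℝ) (E' := ℝ)) hρ u
  have h2 : mvfderiv 𝓘(ℝ, ℝ) Real.log (ρ p) = fderiv ℝ Real.log (ρ p) := by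
    rw [← mfderiv_eq_fderiv]; rfl
  rw [show (fun q => Real.log (ρ q)) = Real.log ∘ ρ from rfl, h1, h2, ← mul_comm]
  have h3 : ∀ y : ℝ, fderiv ℝ Real.log (ρ p) y = y * (ρ p)⁻¹ := fun y => by
    rw [fderiv_eq_smul_deriv, Real.deriv_log, smul_eq_mul]
  exact h3 _

theorem subelliptic_equation
    {o : (p : M) → Orientation ℝ (TangentSpace (𝓡 3) p) (Fin 3)}
    {α : OneForm M} (hα : IsContactForm α) {μ : M → ℝ} (hμ : IsAdapted o α μ)
    {X : VField M} (hX : X.IsSmooth) (hX0 : ∀ p, X p ≠ 0) (hXα : Preserves X α) (p : M) :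
    laplacian (pair α X) p + 1 / ‖X p‖ ^ 2 * hess (pair α X) p (X p) (X p)
      - inner ℝ (grad (fun q => Real.log (1 / (μ q * ‖X q‖))) p) (grad (pair α X) p)
      + μ p * (twist o X p - μ p) * pair α X p = 0 := by
  have hf : ∀ q, ContMDiffAt (𝓡 3) 𝓘(ℝ, ℝ) ∞ (pair α X) q := fun q => hα.smooth.pair_smoothAt (hX q)
  obtain ⟨e, he, he0⟩ := exists_onFrame (hX p) (hX0 p)
  obtain ⟨m, hm, hmq, hmB⟩ := exists_signed_factor hα hμ he
  have hv0 : ∀ q, ‖X q‖ ≠ 0 := fun q => norm_ne_zero_iff.2 (hX0 q)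
  have hXe : ∀ q, X q = ‖X q‖ • e 0 q := fun q => by
    rw [he0, unitField, smul_smul, mul_inv_cancel₀ (hv0 q), one_smul]
  set F : Fin 3 → M → ℝ := fun j q => mvfderiv (𝓡 3) (pair α X) q (e j q) with hF
  have hFs : ∀ j, ContMDiffAt (𝓡 3) 𝓘(ℝ, ℝ) ∞ (F j) p := fun j =>
    contMDiffAt_mvfderiv_apply (hf p) (he.smooth j)
  have hFd : ∀ j, MDifferentiableAt (𝓡 3) 𝓘(ℝ, ℝ) (F j) p := fun j =>
    (hFs j).mdifferentiableAt (by simp)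
  set ρ : M → ℝ := fun q => (‖X q‖ * m q)⁻¹ with hρ
  have hm0 : ∀ᶠ q in 𝓝 p, m q ≠ 0 := hmq.mono fun q hq h0 => by
    rw [h0, abs_zero] at hq
    exact hμ.ne_zero q (abs_eq_zero.1 hq.1.symm)
  have hρ0 : ρ p ≠ 0 := inv_ne_zero (mul_ne_zero (hv0 p) hm0.self_of_nhds)
  have hρs : ContMDiffAt (𝓡 3) 𝓘(ℝ, ℝ) ∞ ρ p :=
    (contDiffAt_inv ℝ (mul_ne_zero (hv0 p) hm0.self_of_nhds)).contMDiffAt.comp p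
      ((norm_smoothAt (hX p) (hX0 p)).mul hm)
  have hρd : MDifferentiableAt (𝓡 3) 𝓘(ℝ, ℝ) ρ p := hρs.mdifferentiableAt (by simp)
  -- The components of `df = -v dα(e₀, ·)`. They hold on a neighbourhood, so they may be
  -- differentiated later.
  have hrel : ∀ᶠ q in 𝓝 p, F 0 q = 0 ∧ α q (e 1 q) = ρ q * F 2 q ∧ α q (e 2 q) = -(ρ q * F 1 q) := by
    filter_upwards [hmq, hm0] with q hq hq0
    obtain ⟨B, hB, hB0⟩ := exists_bilin_dForm (α := α) (p := q)
      (fun hW => hα.smooth.pair_diffAt hW)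
    have hFB : ∀ j, F j q = - (‖X q‖ * B (e 0 q) (e j q)) := fun j => by
      simp only [hF]
      rw [mvfderiv_eq_neg_dForm hα.smooth (hX.smoothAt q).diffAt hXα, hB]
      conv_lhs => rw [hXe q]
      simp
    have h1 : B (e 2 q) (e 0 q) = m q * α q (e 1 q) := by rw [← hB]; exact hq.2 1
    have h2 : B (e 0 q) (e 1 q) = m q * α q (e 2 q) := by rw [← hB]; exact hq.2 2
    have h3 : B (e 0 q) (e 2 q) = - B (e 2 q) (e 0 q) := by
      have h4 := hB0 (e 0 q + e 2 q)
      simp only [map_add, LinearMap.add_apply, hB0] at h4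
      linarith
    have := hv0 q
    refine ⟨by rw [hFB, hB0]; simp, ?_, ?_⟩
    · rw [hFB, h3, h1]; simp only [hρ]; field_simp
    · rw [hFB, h2]; simp only [hρ]; field_simp
  have hgrad : ∀ᶠ q in 𝓝 p, grad (pair α X) q = (F 1 • e 1 + F 2 • e 2) q := by
    filter_upwards [hrel, he.orthonormal] with q hq ho
    have h1 : ∀ j, inner ℝ (e j q) (grad (pair α X) q) = F j q := fun j => by
      rw [real_inner_comm, inner_grad]
    rw [Orthonormal.sum_frame ho (grad (pair α X) q), h1, h1, h1, hq.1]
    simp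
  have hed : ∀ j, DiffAt (e j) p := fun j => (he.smooth j).diffAt
  have ho := orthonormal_iff_ite.1 he.orthonormal.self_of_nhds
  have hbr : ∀ i, inner ℝ (mlieBracket (𝓡 3) (grad (pair α X)) (e i) p) (e i p) =
      - (mvfderiv (𝓡 3) (F 1) p (e i p) * inner ℝ (e 1 p) (e i p))
      + F 1 p * inner ℝ (mlieBracket (𝓡 3) (e 1) (e i) p) (e i p)
      - mvfderiv (𝓡 3) (F 2) p (e i p) * inner ℝ (e 2 p) (e i p)
      + F 2 p * inner ℝ (mlieBracket (𝓡 3) (e 2) (e i) p) (e i p) := fun i => by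
    rw [Filter.EventuallyEq.mlieBracket_vectorField_eq hgrad (EventuallyEq.refl _ (e i)),
      mlieBracket_add_left ((hFd 1).smul_section (hed 1)) ((hFd 2).smul_section (hed 2)),
      mlieBracket_smul_left (hFd 1) (hed 1), mlieBracket_smul_left (hFd 2) (hed 2)]
    simp only [inner_add_left, inner_smul_left, conj_trivial]
    ring
  have hunit : ∀ i, ∀ᶠ q in 𝓝 p, metric (e i) (e i) q = 1 := fun i =>
    he.orthonormal.mono fun q hq => by
      have := orthonormal_iff_ite.1 hq i i
      rwa [if_pos rfl] at this
  have h11 := hess_unit (hf p) (he.smooth 1) (hunit 1)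
  have h22 := hess_unit (hf p) (he.smooth 2) (hunit 2)
  obtain ⟨b, hb⟩ := exists_orthonormalBasis_eq he.orthonormal.self_of_nhds
  obtain ⟨B, hB, -⟩ := exists_bilin_hess (hf p)
  have hlap : laplacian (pair α X) p = -(B (e 0 p) (e 0 p) + B (e 1 p) (e 1 p)
      + B (e 2 p) (e 2 p)) := by
    simp only [laplacian, hB]
    rw [sum_bilin_orthonormal B _ b, Fin.sum_univ_three, hb, hb, hb]
  have hXX : hess (pair α X) p (X p) (X p) = ‖X p‖ ^ 2 * B (e 0 p) (e 0 p) := by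
    rw [hB]
    conv_lhs => rw [hXe p]
    simp; ring
  have hlog : inner ℝ (grad (fun q => Real.log (1 / (μ q * ‖X q‖))) p) (grad (pair α X) p) =
      F 1 p * ((ρ p)⁻¹ * mvfderiv (𝓡 3) ρ p (e 1 p))
      + F 2 p * ((ρ p)⁻¹ * mvfderiv (𝓡 3) ρ p (e 2 p)) := by
    -- The logarithm sees only absolute values, so replacing `μ` by `m = ±μ` changes nothing.
    have h1 : (fun q => Real.log (1 / (μ q * ‖X q‖))) =ᶠ[𝓝 p] fun q => Real.log (ρ q) := by
      filter_upwards [hmq] with q hq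
      rw [← Real.log_abs, ← Real.log_abs (ρ q)]
      simp only [hρ, abs_inv, abs_mul, hq.1, one_div, mul_comm]
    rw [inner_grad, mvfderiv_congr h1, hgrad.self_of_nhds]
    simp only [Pi.add_apply, Pi.smul_apply', map_add, map_smul, smul_eq_mul]
    rw [mvfderiv_log hρd hρ0, mvfderiv_log hρd hρ0]
  have htw : μ p * twist o X p = - (m p * inner ℝ (e 0 p) (mlieBracket (𝓡 3) (e 1) (e 2) p)) := by
    have hM : MForm (unitForm X) p := fun hU => metric_diffAt (unitField_smoothAt (hX p) (hX0 p)).diffAt hU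
    obtain ⟨C, hC, hC0⟩ := exists_bilin_dForm hM
    have h1 : dForm (unitForm X) p = fun u v => C u v := by ext u v; exact hC u v
    have h2 : ∀ i j, i ≠ j → mvfderiv (𝓡 3) (metric (e i) (e j)) p = 0 := fun i j hij => by
      rw [mvfderiv_congr (g := fun _ => 0), mvfderiv_const]
      filter_upwards [he.orthonormal] with q hq
      have := orthonormal_iff_ite.1 hq i j
      rwa [if_neg hij] at this
    rw [twist, h1, ← he0, hmB C hC0, ← hC, dForm_apply hM (hed 1) (hed 2), dField]
    rw [show pair (unitForm X) (e 2) = metric (e 0) (e 2) by rw [he0]; rfl,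
      show pair (unitForm X) (e 1) = metric (e 0) (e 1) by rw [he0]; rfl,
      h2 0 2 (by simp), h2 0 1 (by simp), he0]
    simp [unitForm]
  -- The identity for `dα(e₁, e₂)` is the only one not used in `hrel`; substituting `hrel` into it
  -- produces the second derivatives of `f`.
  have hstr : mvfderiv (𝓡 3) (pair α (e 2)) p (e 1 p) - mvfderiv (𝓡 3) (pair α (e 1)) p (e 2 p)
      - α p (mlieBracket (𝓡 3) (e 1) (e 2) p) = m p * α p (e 0 p) := by
    rw [← (hmq.self_of_nhds.2 0)]
    exact (dForm_apply (fun hW => hα.smooth.pair_diffAt hW) (hed 1) (hed 2)).symm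
  have hd1 : mvfderiv (𝓡 3) (pair α (e 1)) p = mvfderiv (𝓡 3) (ρ * F 2) p :=
    mvfderiv_congr (hrel.mono fun q hq => hq.2.1)
  have hd2 : mvfderiv (𝓡 3) (pair α (e 2)) p = mvfderiv (𝓡 3) (-(ρ * F 1)) p :=
    mvfderiv_congr (hrel.mono fun q hq => hq.2.2)
  have hbrα : α p (mlieBracket (𝓡 3) (e 1) (e 2) p) =
      inner ℝ (e 0 p) (mlieBracket (𝓡 3) (e 1) (e 2) p) * α p (e 0 p)
      + inner ℝ (e 1 p) (mlieBracket (𝓡 3) (e 1) (e 2) p) * α p (e 1 p)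
      + inner ℝ (e 2 p) (mlieBracket (𝓡 3) (e 1) (e 2) p) * α p (e 2 p) := by
    conv_lhs => rw [Orthonormal.sum_frame he.orthonormal.self_of_nhds (mlieBracket (𝓡 3) (e 1) (e 2) p)]
    simp
  obtain ⟨-, hr1, hr2⟩ := hrel.self_of_nhds
  have hfv : pair α X p = ‖X p‖ * α p (e 0 p) := by
    rw [pair]
    conv_lhs => rw [hXe p]
    simp
  have hmm : μ p ^ 2 = m p ^ 2 := by rw [← sq_abs, ← hmq.self_of_nhds.1, sq_abs]
  have hρm : ρ p * (‖X p‖ * m p) = 1 := inv_mul_cancel₀ (mul_ne_zero (hv0 p) hm0.self_of_nhds)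
  rw [hbr] at h11 h22
  rw [hB] at h11 h22
  rw [hd1, hd2, mvfderiv_neg, mvfderiv_mul hρd (hFd 1), mvfderiv_mul hρd (hFd 2), hbrα, hr1, hr2] at hstr
  have h21 : mlieBracket (𝓡 3) (e 2) (e 1) p = - mlieBracket (𝓡 3) (e 1) (e 2) p :=
    mlieBracket_swap_apply
  simp only [ho, mlieBracket_self, h21, inner_neg_left, Pi.zero_apply, inner_zero_left] at h11 h22
  rw [real_inner_comm] at h11 h22
  simp at h11 h22 hstr
  rw [hlap, hXX, hlog, mul_sub, htw, h11, h22, hfv]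
  have hv := hv0 p
  have hinv : (ρ p)⁻¹ = ‖X p‖ * m p := inv_inv _
  have hB0 : 1 / ‖X p‖ ^ 2 * (‖X p‖ ^ 2 * B (e 0 p) (e 0 p)) = B (e 0 p) (e 0 p) := by
    field_simp
  rw [hB0, hinv]
  -- Multiplying by `v m = 1/ρ` clears `ρ` from the second order and bracket terms, leaves `dρ/ρ` on
  -- the first order ones, and turns the right side into `m² f = μ² f`.
  linear_combination (‖X p‖ * m p) * hstr - ‖X p‖ * α p (e 0 p) * hmm
    + (F 2 p * inner ℝ (e 1 p) (mlieBracket (𝓡 3) (e 1) (e 2) p)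
      + mvfderiv (𝓡 3) (F 1) p (e 1 p) + mvfderiv (𝓡 3) (F 2) p (e 2 p)
      - F 1 p * inner ℝ (e 2 p) (mlieBracket (𝓡 3) (e 1) (e 2) p)) * hρm

end Subelliptic

/-! ### The Reeb field and its commutation with `X`. -/

section Reeb

variable {M : Type*} [TopologicalSpace M] [ChartedSpace E3 M] [IsManifold (𝓡 3) ∞ M]
  [RiemannianBundle (fun p : M => TangentSpace (𝓡 3) p)]

/-- The metric dual of a 1-form. -/
def sharp (α : OneForm M) : VField M := fun p =>
  haveI : CompleteSpace (TangentSpace (𝓡 3) p) := FiniteDimensional.complete ℝ _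
  (InnerProductSpace.toDual ℝ (TangentSpace (𝓡 3) p)).symm (α p)

theorem inner_sharp (α : OneForm M) (q : M) (u : TangentSpace (𝓡 3) q) :
    inner ℝ (sharp α q) u = α q u := by
  haveI : CompleteSpace (TangentSpace (𝓡 3) q) := FiniteDimensional.complete ℝ _
  exact InnerProductSpace.toDual_symm_apply

/-- The Reeb field of a contact form with an adapted metric. -/
def reeb (α : OneForm M) : VField M := fun p => (‖sharp α p‖ ^ 2)⁻¹ • sharp α p

theorem sharp_ne_zero {α : OneForm M} (hα : IsContactForm α) (q : M) : sharp α q ≠ 0 := by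
  intro h
  refine hα.ne_zero q ?_
  ext u
  rw [← inner_sharp, h, inner_zero_left]; rfl

theorem apply_reeb {α : OneForm M} (hα : IsContactForm α) (q : M) : α q (reeb α q) = 1 := by
  have := norm_ne_zero_iff.2 (sharp_ne_zero hα q)
  rw [reeb, map_smul, ← inner_sharp, real_inner_self_eq_norm_sq, smul_eq_mul]
  field_simp

variable {o : (p : M) → Orientation ℝ (TangentSpace (𝓡 3) p) (Fin 3)} {α : OneForm M} {μ : M → ℝ}

/-- With `a = (α(b i))`, the three formulas say `dα(u, ·) = m ⟨a × u, ·⟩`. -/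
theorem IsAdapted.exists_basis (hα : IsContactForm α) (hμ : IsAdapted o α μ) (q : M) :
    ∃ (b : OrthonormalBasis (Fin 3) ℝ (TangentSpace (𝓡 3) q)) (m : ℝ)
      (B : TangentSpace (𝓡 3) q →ₗ[ℝ] TangentSpace (𝓡 3) q →ₗ[ℝ] ℝ), m ≠ 0 ∧
      (∀ u v, dForm α q u v = B u v) ∧
      ∀ u, B u (b 0) = m * (inner ℝ (b 2) u * α q (b 1) - inner ℝ (b 1) u * α q (b 2)) ∧
        B u (b 1) = m * (inner ℝ (b 0) u * α q (b 2) - inner ℝ (b 2) u * α q (b 0)) ∧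
        B u (b 2) = m * (inner ℝ (b 1) u * α q (b 0) - inner ℝ (b 0) u * α q (b 1)) := by
  obtain ⟨B, hB, hB0⟩ := exists_bilin_dForm (α := α) (p := q) (fun hW => hα.smooth.pair_diffAt hW)
  set b := (o q).finOrthonormalBasis (by norm_num) (finrank_tangentSpace q)
  obtain ⟨ε, hε, h⟩ := exists_sign_hodgeStar (finrank_tangentSpace q) (o q) b
  have hd : dForm α q = fun u v => B u v := by ext u v; exact hB u v
  obtain ⟨h0, h1, h2⟩ := h B hB0
  rw [← hd, hμ.beltrami] at h0 h1 h2
  have hanti : ∀ u v, B u v = - B v u := fun u v => by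
    have h4 := hB0 (u + v)
    simp only [map_add, LinearMap.add_apply, hB0] at h4
    linarith
  have hε0 : ε ≠ 0 := fun h => by simp [h] at hε
  have g0 : B (b 1) (b 2) = ε * μ q * α q (b 0) := by
    linear_combination -ε * h0 - B (b 1) (b 2) * hε
  have g1 : B (b 2) (b 0) = ε * μ q * α q (b 1) := by
    linear_combination -ε * h1 - B (b 2) (b 0) * hε
  have g2 : B (b 0) (b 1) = ε * μ q * α q (b 2) := by
    linear_combination -ε * h2 - B (b 0) (b 1) * hε
  refine ⟨b, ε * μ q, B, mul_ne_zero hε0 (hμ.ne_zero q), hB, fun u => ?_⟩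
  have hu := b.sum_repr' u
  rw [Fin.sum_univ_three] at hu
  have hBu : ∀ i, B u (b i) = inner ℝ (b 0) u * B (b 0) (b i) + inner ℝ (b 1) u * B (b 1) (b i)
      + inner ℝ (b 2) u * B (b 2) (b i) := fun i => by
    conv_lhs => rw [← hu]
    simp
  refine ⟨?_, ?_, ?_⟩
  · rw [hBu, hB0, hanti (b 1) (b 0), g1, g2]; ring
  · rw [hBu, hB0, hanti (b 2) (b 1), g0, g2]; ring
  · rw [hBu, hB0, hanti (b 0) (b 2), g0, g1]; ring

/-- `reeb α` is a multiple of the dual vector `a`, and `a × a = 0`. -/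
theorem dForm_reeb (hα : IsContactForm α) (hμ : IsAdapted o α μ) (q : M)
    (v : TangentSpace (𝓡 3) q) : dForm α q (reeb α q) v = 0 := by
  obtain ⟨b, m, B, -, hB, h⟩ := hμ.exists_basis hα q
  obtain ⟨h0, h1, h2⟩ := h (sharp α q)
  simp only [real_inner_comm (sharp α q), inner_sharp] at h0 h1 h2
  rw [hB, reeb, map_smul, LinearMap.smul_apply, ← b.sum_repr' v, Fin.sum_univ_three]
  simp only [map_add, map_smul, h0, h1, h2, smul_eq_mul]
  ring

/-- If `a · u = 0` and `a × u = 0`, then `|a|² u = 0`, and `a ≠ 0` because a contact form vanishes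
nowhere. -/
theorem eq_zero_of_dForm_eq_zero (hα : IsContactForm α) (hμ : IsAdapted o α μ) {q : M}
    {u : TangentSpace (𝓡 3) q} (h0 : α q u = 0) (h1 : ∀ v, dForm α q u v = 0) : u = 0 := by
  obtain ⟨b, m, B, hm, hB, h⟩ := hμ.exists_basis hα q
  obtain ⟨e0, e1, e2⟩ := h u
  have hu := b.sum_repr' u
  rw [Fin.sum_univ_three] at hu
  have hα0 : inner ℝ (b 0) u * α q (b 0) + inner ℝ (b 1) u * α q (b 1)
      + inner ℝ (b 2) u * α q (b 2) = 0 := by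
    rw [← h0]; conv_rhs => rw [← hu]
    simp
  rw [← hB, h1, eq_comm, mul_eq_zero, or_iff_right hm] at e0 e1 e2
  have hne : α q (b 0) ^ 2 + α q (b 1) ^ 2 + α q (b 2) ^ 2 ≠ 0 := fun hs => by
    have g0 : α q (b 0) = 0 := by nlinarith [sq_nonneg (α q (b 0)), sq_nonneg (α q (b 1)), sq_nonneg (α q (b 2))]
    have g1 : α q (b 1) = 0 := by nlinarith [sq_nonneg (α q (b 0)), sq_nonneg (α q (b 1)), sq_nonneg (α q (b 2))]
    have g2 : α q (b 2) = 0 := by nlinarith [sq_nonneg (α q (b 0)), sq_nonneg (α q (b 1)), sq_nonneg (α q (b 2))]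
    refine hα.ne_zero q ?_
    ext w
    rw [← b.sum_repr' w, Fin.sum_univ_three]
    simp [g0, g1, g2]
  set a0 := α q (b 0)
  set a1 := α q (b 1)
  set a2 := α q (b 2)
  have z0 : inner ℝ (b 0) u = (0 : ℝ) := by
    refine (mul_eq_zero.1 ?_).resolve_right hne
    linear_combination a0 * hα0 + a2 * e1 - a1 * e2
  have z1 : inner ℝ (b 1) u = (0 : ℝ) := by
    refine (mul_eq_zero.1 ?_).resolve_right hne
    linear_combination a1 * hα0 + a0 * e2 - a2 * e0
  have z2 : inner ℝ (b 2) u = (0 : ℝ) := by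
    refine (mul_eq_zero.1 ?_).resolve_right hne
    linear_combination a2 * hα0 + a1 * e0 - a0 * e1
  rw [← hu, z0, z1, z2]; simp

variable [IsContMDiffRiemannianBundle (𝓡 3) ∞ E3 (fun p : M => TangentSpace (𝓡 3) p)]

theorem reeb_smoothAt (hα : IsContactForm α) (p : M) : SmoothAt (reeb α) p := by
  obtain ⟨e, he⟩ := exists_onFrame_at p
  have hs : SmoothAt (sharp α) p := by
    refine he.smoothAt_of_inner fun i => ?_
    have : metric (e i) (sharp α) = pair α (e i) := by
      ext q; rw [metric, real_inner_comm, inner_sharp]; rfl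
    rw [this]
    exact hα.smooth.pair_smoothAt (he.smooth i)
  have h0 := sharp_ne_zero hα p
  refine SmoothAt.smul ?_ hs
  exact (contDiffAt_inv ℝ (pow_ne_zero 2 (norm_ne_zero_iff.2 h0))).contMDiffAt.comp p
    ((norm_smoothAt hs h0).pow 2)

/-- By `eq_zero_of_dForm_eq_zero` it suffices that `α` and `dα` vanish on `Z = [X, R]`. First, `α(Z)
= X(α(R)) = 0`. Then `dα(Z, V) = Z(α(V)) - α([Z, V])`; the Jacobi identity and the invariance of `α`
under both `X` and `R` make the two terms equal. -/
theorem mlieBracket_reeb (hα : IsContactForm α) (hμ : IsAdapted o α μ) {X : VField M}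
    (hX : X.IsSmooth) (hXα : Preserves X α) (p : M) : mlieBracket (𝓡 3) X (reeb α) p = 0 := by
  have hR := reeb_smoothAt hα
  have hZ : ∀ q, SmoothAt (mlieBracket (𝓡 3) X (reeb α)) q := fun q => (hX.smoothAt q).mlieBracket (hR q)
  have hpR : pair α (reeb α) = fun _ => 1 := funext fun q => apply_reeb hα q
  have hαZ : ∀ q, α q (mlieBracket (𝓡 3) X (reeb α) q) = 0 := fun q => by
    rw [← lieDeriv_eq_zero hα.smooth hXα (hR q).diffAt, hpR, mvfderiv_const]; rfl
  have hRV : ∀ {V : VField M} {q : M}, DiffAt V q →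
      mvfderiv (𝓡 3) (pair α V) q (reeb α q) = α q (mlieBracket (𝓡 3) (reeb α) V q) := by
    intro V q hV
    have h1 := dForm_apply (fun hW => hα.smooth.pair_diffAt hW) (hR q).diffAt hV
    rw [dForm_reeb hα hμ, dField, hpR, mvfderiv_const] at h1
    simp at h1
    linarith
  refine eq_zero_of_dForm_eq_zero hα hμ (hαZ p) fun v => ?_
  have hV := smoothAt_ext v
  have hMp : MForm α p := fun hW => hα.smooth.pair_diffAt hW
  have h1 := dForm_apply hMp (hZ p).diffAt hV.diffAt
  have hp0 : pair α (mlieBracket (𝓡 3) X (reeb α)) = fun _ => 0 := funext hαZ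
  have : IsManifold (𝓡 3) (minSmoothness ℝ 3) M := isManifold_minSmoothness M 3
  have hle : minSmoothness ℝ 2 ≤ (∞ : WithTop ℕ∞) := by
    rw [minSmoothness_of_isRCLikeNormedField]; exact nat_le_infty 2
  have hJ := leibniz_identity_mlieBracket_apply (I := 𝓡 3) ((hX.smoothAt p).of_le hle)
    ((hR p).of_le hle) (hV.of_le hle)
  have hJ2 : mlieBracket (𝓡 3) (mlieBracket (𝓡 3) X (reeb α)) (ext v) p =
      mlieBracket (𝓡 3) X (mlieBracket (𝓡 3) (reeb α) (ext v)) p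
      - mlieBracket (𝓡 3) (reeb α) (mlieBracket (𝓡 3) X (ext v)) p := by
    rw [hJ]; abel
  have e1 : (fun q => mvfderiv (𝓡 3) (pair α (ext v)) q (reeb α q)) =ᶠ[𝓝 p]
      pair α (mlieBracket (𝓡 3) (reeb α) (ext v)) := hV.eventually_diffAt.mono fun q hq => hRV hq
  have e2 : (fun q => mvfderiv (𝓡 3) (pair α (ext v)) q (X q)) =ᶠ[𝓝 p]
      pair α (mlieBracket (𝓡 3) X (ext v)) :=
    hV.eventually_diffAt.mono fun q hq => lieDeriv_eq_zero hα.smooth hXα hq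
  rw [ext_self] at h1
  rw [h1, dField, hp0, mvfderiv_const, hJ2, map_sub,
    mvfderiv_mlieBracket (hα.smooth.pair_smoothAt hV) (hX.smoothAt p) (hR p),
    mvfderiv_congr e1, mvfderiv_congr e2,
    lieDeriv_eq_zero hα.smooth hXα ((hR p).mlieBracket hV).diffAt,
    hRV ((hX.smoothAt p).mlieBracket hV).diffAt]
  simp

end Reeb

/-! ### Flow coordinates on a level surface in Euclidean space. -/

section Leaf

/-- A smooth map with invertible derivative at a point restricts to a diffeomorphism. -/
theorem exists_local_diffeo {E F : Type*} [NormedAddCommGroup E] [NormedSpace ℝ E]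
    [CompleteSpace E] [NormedAddCommGroup F] [NormedSpace ℝ F] {K : E → F} {Ω : Set E} {y₀ : E}
    (hΩ : IsOpen Ω) (hy₀ : y₀ ∈ Ω) (hK : ContDiffOn ℝ ∞ K Ω) {K' : E ≃L[ℝ] F}
    (hK' : HasFDerivAt K (K' : E →L[ℝ] F) y₀) :
    ∃ e : OpenPartialHomeomorph E F, (⇑e = K) ∧ y₀ ∈ e.source ∧ e.source ⊆ Ω ∧
      ContDiffOn ℝ ∞ e.symm e.target := by
  have hKat : ∀ y ∈ Ω, ContDiffAt ℝ ∞ K y := fun y hy => hK.contDiffAt (hΩ.mem_nhds hy)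
  have h0 : ContDiffAt ℝ ∞ K y₀ := hKat y₀ hy₀
  let e₀ := h0.toOpenPartialHomeomorph K hK' (by simp)
  have he₀ : ⇑e₀ = K := h0.toOpenPartialHomeomorph_coe hK' (by simp)
  have hmem : y₀ ∈ e₀.source := h0.mem_toOpenPartialHomeomorph_source hK' (by simp)
  have hc : ContinuousAt (fderiv ℝ K) y₀ :=
    (h0.fderiv_right (m := 0) (by simp)).continuousAt
  -- Invertible operators form an open set. Shrinking the source to where the derivative is
  -- invertible makes the inverse smooth on the whole target, not just at the image of `y₀`.
  have hinv : ∀ᶠ y in 𝓝 y₀, fderiv ℝ K y ∈ range ((↑) : (E ≃L[ℝ] F) → E →L[ℝ] F) := by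
    refine hc.eventually_mem ?_
    rw [hK'.fderiv]
    exact K'.nhds
  obtain ⟨S, hS, hSo, hyS⟩ := mem_nhds_iff.1 (Filter.inter_mem hinv (hΩ.mem_nhds hy₀))
  refine ⟨e₀.restrOpen S hSo, he₀, ⟨hmem, hyS⟩, fun y hy => (hS hy.2).2, fun u hu => ?_⟩
  refine ContDiffAt.contDiffWithinAt ?_
  have hs : (e₀.restrOpen S hSo).symm u ∈ S := ((e₀.restrOpen S hSo).map_target hu).2
  obtain ⟨⟨T, hT⟩, hsΩ⟩ := hS hs
  have hKs := hKat _ hsΩ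
  refine OpenPartialHomeomorph.contDiffAt_symm _ hu (f₀' := T) ?_ ?_
  · rw [hT]
    exact (hKs.differentiableAt (by simp)).hasFDerivAt
  · exact hKs

/-- Near a point of a common level surface, two commuting vector fields that are tangent to the
level sets of `f` are the coordinate fields of a parametrization of the level set. -/
theorem exists_commuting_parametrization {V W : E3 → E3} {f : E3 → ℝ} {Ω : Set E3} {y₀ : E3}
    (hΩ : IsOpen Ω) (hy₀ : y₀ ∈ Ω) (hV : ContDiffOn ℝ ∞ V Ω) (hW : ContDiffOn ℝ ∞ W Ω)
    (hf : ContDiffOn ℝ ∞ f Ω) (hVW : ∀ y ∈ Ω, lieBracket ℝ V W y = 0)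
    (hfV : ∀ y ∈ Ω, fderiv ℝ f y (V y) = 0) (hfW : ∀ y ∈ Ω, fderiv ℝ f y (W y) = 0)
    (hf0 : fderiv ℝ f y₀ ≠ 0) (hli : ∀ a b : ℝ, a • V y₀ + b • W y₀ = 0 → a = 0 ∧ b = 0) :
    ∃ (δ : ℝ) (G : ℝ × ℝ → E3) (θ : E3 → ℝ × ℝ) (U : Set E3), 0 < δ ∧ IsOpen U ∧ y₀ ∈ U ∧ U ⊆ Ω ∧
      θ y₀ = 0 ∧ G 0 = y₀ ∧ ContinuousOn θ U ∧
      (∀ u ∈ Metric.ball (0 : ℝ × ℝ) δ, G u ∈ U ∧ f (G u) = f y₀ ∧ θ (G u) = u ∧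
        ContDiffAt ℝ ∞ G u ∧ ∀ a b : ℝ, fderiv ℝ G u (a, b) = a • V (G u) + b • W (G u)) ∧
      ∀ y ∈ U, f y = f y₀ → θ y ∈ Metric.ball (0 : ℝ × ℝ) δ ∧ G (θ y) = y := by
  have at_ : ∀ {F : Type} [NormedAddCommGroup F] [NormedSpace ℝ F] {g : E3 → F},
      ContDiffOn ℝ ∞ g Ω → ∀ y ∈ Ω, ContDiffAt ℝ ∞ g y :=
    fun hg y hy => hg.contDiffAt (hΩ.mem_nhds hy)
  -- a projection adapted to `V` and `W` at the base point
  obtain ⟨N, hN⟩ : ∃ N, fderiv ℝ f y₀ N ≠ 0 := by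
    by_contra! h
    exact hf0 (ContinuousLinearMap.ext h)
  have hlin : LinearIndependent ℝ ![V y₀, W y₀, N] := by
    rw [Fintype.linearIndependent_iff]
    intro g hg
    rw [Fin.sum_univ_three] at hg
    simp only [Matrix.cons_val_zero, Matrix.cons_val_one, Matrix.cons_val] at hg
    have h1 := congrArg (fderiv ℝ f y₀) hg
    simp only [map_add, map_smul, hfV _ hy₀, hfW _ hy₀, smul_eq_mul, mul_zero, zero_add,
      map_zero, mul_eq_zero, or_iff_left hN] at h1
    rw [h1, zero_smul, add_zero] at hg
    have h2 := hli _ _ hg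
    intro i
    fin_cases i
    exacts [h2.1, h2.2, h1]
  let bas := basisOfLinearIndependentOfCardEqFinrank hlin (by simp)
  have hbas : ⇑bas = ![V y₀, W y₀, N] := coe_basisOfLinearIndependentOfCardEqFinrank _ _
  let P : E3 →L[ℝ] ℝ × ℝ := LinearMap.toContinuousLinearMap ((bas.coord 0).prod (bas.coord 1))
  have hP : ∀ y, P y = (bas.repr y 0, bas.repr y 1) := fun y => rfl
  have hb0 : bas 0 = V y₀ := by rw [hbas]; rfl
  have hb1 : bas 1 = W y₀ := by rw [hbas]; rfl
  have hPV : P (V y₀) = (1, 0) := by rw [hP, ← hb0]; simp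
  have hPW : P (W y₀) = (0, 1) := by rw [hP, ← hb1]; simp
  let L : E3 →L[ℝ] (ℝ × ℝ) × ℝ := P.prod (fderiv ℝ f y₀)
  have hLinj : Function.Injective L := by
    rw [injective_iff_map_eq_zero]
    intro u hu
    have hu' := bas.sum_repr u
    rw [Fin.sum_univ_three, hb0, hb1, show bas 2 = N by rw [hbas]; rfl] at hu'
    have h1 : P u = 0 := congrArg Prod.fst hu
    have h2 : fderiv ℝ f y₀ u = 0 := congrArg Prod.snd hu
    rw [hP, Prod.mk_eq_zero] at h1
    rw [h1.1, h1.2, zero_smul, zero_smul, zero_add, zero_add] at hu'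
    rw [← hu', map_smul, smul_eq_mul, mul_eq_zero, or_iff_left hN] at h2
    rw [← hu', h2, zero_smul]
  let L' : E3 ≃L[ℝ] (ℝ × ℝ) × ℝ :=
    (LinearMap.linearEquivOfInjective L.toLinearMap hLinj (by simp)).toContinuousLinearEquiv
  let K : E3 → (ℝ × ℝ) × ℝ := fun y => (P y, f y)
  have hK : ContDiffOn ℝ ∞ K Ω := P.contDiff.contDiffOn.prodMk hf
  have hKd : ∀ y ∈ Ω, HasFDerivAt K (P.prod (fderiv ℝ f y)) y := fun y hy =>
    P.hasFDerivAt.prodMk ((at_ hf y hy).differentiableAt (by simp)).hasFDerivAt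
  obtain ⟨e, heK, hye, heΩ, hes⟩ := exists_local_diffeo hΩ hy₀ hK (K' := L') (hKd y₀ hy₀)
  -- the level set as a graph
  set c := f y₀ with hc
  let Z : Set (ℝ × ℝ) := {z | (z, c) ∈ e.target}
  have hZ : IsOpen Z := e.open_target.preimage (by fun_prop)
  let ι : ℝ × ℝ → E3 := fun z => e.symm (z, c)
  have hιs : ∀ z ∈ Z, ι z ∈ e.source := fun z hz => e.map_target hz
  have hKι : ∀ z ∈ Z, K (ι z) = (z, c) := fun z hz => by rw [← heK]; exact e.right_inv hz
  have hPι : ∀ z ∈ Z, P (ι z) = z := fun z hz => congrArg Prod.fst (hKι z hz)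
  have hfι : ∀ z ∈ Z, f (ι z) = c := fun z hz => congrArg Prod.snd (hKι z hz)
  have hes' : ∀ z ∈ Z, ContDiffAt ℝ ∞ e.symm (z, c) := fun z hz =>
    hes.contDiffAt (e.open_target.mem_nhds hz)
  have hιc : ∀ z ∈ Z, ContDiffAt ℝ ∞ ι z := fun z hz =>
    (hes' z hz).comp z (contDiffAt_id.prodMk contDiffAt_const)
  -- A vector tangent to the level set is recovered from its projection: differentiate `e.symm ∘ K =
  -- id`, where the last component of `DK(v)` is zero.
  have hιd : ∀ z ∈ Z, ∀ v : E3, fderiv ℝ f (ι z) v = 0 → fderiv ℝ ι z (P v) = v := by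
    intro z hz v hv
    have h1 : HasFDerivAt ι ((fderiv ℝ e.symm (z, c)).comp
        ((ContinuousLinearMap.id ℝ (ℝ × ℝ)).prod 0)) z :=
      ((hes' z hz).differentiableAt (by simp)).hasFDerivAt.comp z
        ((hasFDerivAt_id z).prodMk (hasFDerivAt_const c z))
    have h2 : HasFDerivAt (e.symm ∘ K) ((fderiv ℝ e.symm (z, c)).comp
        (P.prod (fderiv ℝ f (ι z)))) (ι z) := by
      refine HasFDerivAt.comp _ ?_ (hKd _ (heΩ (hιs z hz)))
      rw [hKι z hz]
      exact ((hes' z hz).differentiableAt (by simp)).hasFDerivAt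
    have h3 : HasFDerivAt (e.symm ∘ K) (ContinuousLinearMap.id ℝ E3) (ι z) := by
      refine (hasFDerivAt_id _).congr_of_eventuallyEq ?_
      filter_upwards [e.open_source.mem_nhds (hιs z hz)] with y hy
      rw [← heK]; exact e.left_inv hy
    have h4 := congrArg (fun T => T v) (h2.unique h3)
    simp [hv] at h4
    rw [h1.fderiv]
    simpa using h4
  -- the coordinate fields on the graph
  let r : ℝ × ℝ → ℝ × ℝ := fun z => P (V (ι z))
  let x : ℝ × ℝ → ℝ × ℝ := fun z => P (W (ι z))
  have hιΩ : ∀ z ∈ Z, ι z ∈ Ω := fun z hz => heΩ (hιs z hz)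
  have hιr : ∀ z ∈ Z, fderiv ℝ ι z (r z) = V (ι z) := fun z hz => hιd z hz _ (hfV _ (hιΩ z hz))
  have hιx : ∀ z ∈ Z, fderiv ℝ ι z (x z) = W (ι z) := fun z hz => hιd z hz _ (hfW _ (hιΩ z hz))
  have hrc : ∀ z ∈ Z, ContDiffAt ℝ ∞ r z := fun z hz =>
    P.contDiff.contDiffAt.comp z ((at_ hV _ (hιΩ z hz)).comp z (hιc z hz))
  have hxc : ∀ z ∈ Z, ContDiffAt ℝ ∞ x z := fun z hz =>
    P.contDiff.contDiffAt.comp z ((at_ hW _ (hιΩ z hz)).comp z (hιc z hz))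
  have hrd : ∀ z ∈ Z, ∀ u, fderiv ℝ r z u = P (fderiv ℝ V (ι z) (fderiv ℝ ι z u)) := by
    intro z hz u
    have h1 := (P.hasFDerivAt (x := V (ι z))).comp z
      (((at_ hV _ (hιΩ z hz)).differentiableAt (by simp)).hasFDerivAt.comp z
        ((hιc z hz).differentiableAt (by simp)).hasFDerivAt)
    exact congrArg (fun T => T u) h1.fderiv
  have hxd : ∀ z ∈ Z, ∀ u, fderiv ℝ x z u = P (fderiv ℝ W (ι z) (fderiv ℝ ι z u)) := by
    intro z hz u
    have h1 := (P.hasFDerivAt (x := W (ι z))).comp z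
      (((at_ hW _ (hιΩ z hz)).differentiableAt (by simp)).hasFDerivAt.comp z
        ((hιc z hz).differentiableAt (by simp)).hasFDerivAt)
    exact congrArg (fun T => T u) h1.fderiv
  have hcomm : ∀ z ∈ Z, fderiv ℝ r z (x z) = fderiv ℝ x z (r z) := by
    intro z hz
    have h1 := hVW _ (hιΩ z hz)
    rw [lieBracket, sub_eq_zero] at h1
    rw [hrd z hz, hxd z hz, hιr z hz, hιx z hz, h1]
  let fst' := ContinuousLinearMap.fst ℝ ℝ ℝ
  let snd' := ContinuousLinearMap.snd ℝ ℝ ℝ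
  let A : ℝ × ℝ → (ℝ × ℝ →L[ℝ] ℝ × ℝ) := fun z => fst'.smulRight (r z) + snd'.smulRight (x z)
  have hA : ∀ z a b, A z (a, b) = a • r z + b • x z := fun z a b => rfl
  have hAc : ∀ z ∈ Z, ContDiffAt ℝ ∞ A z := fun z hz =>
    (contDiffAt_const.smulRight (hrc z hz)).add (contDiffAt_const.smulRight (hxc z hz))
  set z₀ := P y₀ with hz₀
  have hey : e y₀ = (z₀, c) := by rw [heK]
  have hz₀Z : z₀ ∈ Z := by
    show (z₀, c) ∈ e.target
    rw [← hey]; exact e.map_source hye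
  have hιz₀ : ι z₀ = y₀ := by
    show e.symm (z₀, c) = y₀
    rw [← hey]; exact e.left_inv hye
  have hA0 : A z₀ = ((ContinuousLinearEquiv.refl ℝ (ℝ × ℝ) : (ℝ × ℝ) ≃L[ℝ] (ℝ × ℝ)) :
      ℝ × ℝ →L[ℝ] ℝ × ℝ) := by
    ext <;> simp [A, r, x, hιz₀, hPV, hPW, fst', snd']
  have hinv : ∀ᶠ z in 𝓝 z₀, A z ∈ range ((↑) : ((ℝ × ℝ) ≃L[ℝ] (ℝ × ℝ)) → _) := by
    refine (hAc z₀ hz₀Z).continuousAt.eventually_mem ?_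
    rw [hA0]
    exact ContinuousLinearEquiv.nhds _
  obtain ⟨η, hη, hball⟩ := Metric.mem_nhds_iff.1 (Filter.inter_mem hinv (hZ.mem_nhds hz₀Z))
  set D := Metric.ball z₀ η with hD
  have hDo : IsOpen D := Metric.isOpen_ball
  have hDZ : ∀ z ∈ D, z ∈ Z := fun z hz => (hball hz).2
  have hz₀D : z₀ ∈ D := Metric.mem_ball_self hη
  choose! T hT using fun z (hz : z ∈ D) => (hball hz).1
  -- The coframe dual to the projected fields `r, x`. The coordinates whose coordinate fields are
  -- `r, x` are a primitive of `β`.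
  let β : ℝ × ℝ → (ℝ × ℝ →L[ℝ] ℝ × ℝ) := fun z => (A z).inverse
  have hβT : ∀ z ∈ D, β z = ((T z).symm : ℝ × ℝ →L[ℝ] ℝ × ℝ) := fun z hz => by
    show (A z).inverse = _
    rw [← hT z hz, ContinuousLinearMap.inverse_equiv]
  have hβA : ∀ z ∈ D, ∀ u, β z (A z u) = u := fun z hz u => by
    rw [hβT z hz, ← hT z hz]; simp
  have hAβ : ∀ z ∈ D, ∀ u, A z (β z u) = u := fun z hz u => by
    rw [hβT z hz, ← hT z hz]; simp
  have hβc : ∀ z ∈ D, ContDiffAt ℝ ∞ β z := fun z hz => by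
    have h1 : ContDiffAt ℝ ∞ ContinuousLinearMap.inverse (A z) := by
      rw [← hT z hz]
      exact contDiffAt_map_inverse _
    exact h1.comp z (hAc z (hDZ z hz))
  have hβd : ∀ z ∈ D, DifferentiableAt ℝ β z := fun z hz => (hβc z hz).differentiableAt (by simp)
  have hβr : ∀ z ∈ D, β z (r z) = (1, 0) := fun z hz => by
    have := hβA z hz (1, 0)
    rwa [hA, one_smul, zero_smul, add_zero] at this
  have hβx : ∀ z ∈ D, β z (x z) = (0, 1) := fun z hz => by
    have := hβA z hz (0, 1)
    rwa [hA, one_smul, zero_smul, zero_add] at this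
  have hleib : ∀ z ∈ D, ∀ (s : ℝ × ℝ → ℝ × ℝ) (k : ℝ × ℝ), ContDiffAt ℝ ∞ s z →
      (∀ z' ∈ D, β z' (s z') = k) → ∀ v, fderiv ℝ β z v (s z) = - β z (fderiv ℝ s z v) := by
    intro z hz s k hs hk v
    have h1 := (hβd z hz).hasFDerivAt.clm_apply (hs.differentiableAt (by simp)).hasFDerivAt
    have h2 : HasFDerivAt (fun y => β y (s y)) (0 : ℝ × ℝ →L[ℝ] ℝ × ℝ) z := by
      refine (hasFDerivAt_const k z).congr_of_eventuallyEq ?_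
      filter_upwards [hDo.mem_nhds hz] with y hy using hk y hy
    have h3 := congrArg (fun S => S v) (h1.unique h2)
    simp at h3
    rw [eq_neg_iff_add_eq_zero, add_comm]
    exact h3
  -- Closedness of `β`. Only the pair `r, x` has to be tested, and there it is `[r, x] = 0`, by
  -- differentiating the constants `β(r)` and `β(x)`. The Poincaré lemma on the ball then gives the
  -- primitive `h`.
  have hsymm : ∀ z ∈ D, ∀ u v, fderiv ℝ β z u v = fderiv ℝ β z v u := by
    intro z hz u v
    have h1 : fderiv ℝ β z (x z) (r z) = fderiv ℝ β z (r z) (x z) := by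
      rw [hleib z hz r _ (hrc z (hDZ z hz)) hβr, hleib z hz x _ (hxc z (hDZ z hz)) hβx,
        hcomm z (hDZ z hz)]
    obtain ⟨⟨a, b⟩, rfl⟩ : ∃ w, A z w = u := ⟨_, hAβ z hz u⟩
    obtain ⟨⟨a', b'⟩, rfl⟩ : ∃ w, A z w = v := ⟨_, hAβ z hz v⟩
    simp only [hA, map_add, map_smul, add_apply, smul_apply, h1]
    module
  obtain ⟨h, hh⟩ := (convex_ball z₀ η).exists_forall_hasFDerivAt_of_fderiv_symmetric hDo
    (fun z hz => (hβd z hz).differentiableWithinAt) hsymm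
  let h₀ : ℝ × ℝ → ℝ × ℝ := fun z => h z - h z₀
  have hh₀ : ∀ z ∈ D, HasFDerivAt h₀ (β z) z := fun z hz => (hh z hz).sub_const _
  have hh₀c : ContDiffOn ℝ ∞ h₀ D := by
    rw [contDiffOn_infty_iff_fderiv_of_isOpen hDo]
    refine ⟨fun z hz => (hh₀ z hz).differentiableAt.differentiableWithinAt, ?_⟩
    exact ContDiffOn.congr (fun z hz => (hβc z hz).contDiffWithinAt) fun z hz => (hh₀ z hz).fderiv
  obtain ⟨e', he', hze', he'D, he's⟩ := exists_local_diffeo hDo hz₀D hh₀c (K' := (T z₀).symm)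
    (by rw [← hβT z₀ hz₀D]; exact hh₀ z₀ hz₀D)
  have he'z : e' z₀ = 0 := by rw [he']; simp [h₀]
  obtain ⟨δ, hδ, hδt⟩ := Metric.mem_nhds_iff.1 (e'.open_target.mem_nhds (e'.map_source hze'))
  rw [he'z] at hδt
  have hsymD : ∀ u ∈ Metric.ball (0 : ℝ × ℝ) δ, e'.symm u ∈ D := fun u hu =>
    he'D (e'.map_target (hδt hu))
  refine ⟨δ, ι ∘ e'.symm, h₀ ∘ P,
    e.source ∩ P ⁻¹' (e'.source ∩ e' ⁻¹' Metric.ball 0 δ), hδ, ?_, ⟨hye, hze', ?_⟩,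
    fun y hy => heΩ hy.1, ?_, ?_, ?_, ?_, ?_⟩
  · exact e.open_source.inter
      ((e'.isOpen_inter_preimage Metric.isOpen_ball).preimage P.continuous)
  · show e' z₀ ∈ Metric.ball 0 δ
    rw [he'z]; exact Metric.mem_ball_self hδ
  · show h₀ z₀ = 0
    simp [h₀]
  · show ι (e'.symm 0) = y₀
    rw [← he'z, e'.left_inv hze', hιz₀]
  · refine ContinuousOn.comp (t := D) (fun z hz => (hh₀ z hz).continuousAt.continuousWithinAt)
      P.continuous.continuousOn fun y hy => he'D hy.2.1
  · intro u hu
    have hz := hsymD u hu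
    have hzs := e'.map_target (hδt hu)
    have hr := e'.right_inv (hδt hu)
    set z := e'.symm u with hzu
    have hθ : h₀ (P (ι z)) = u := by rw [hPι z (hDZ z hz), ← he', hr]
    have he'c : ContDiffAt ℝ ∞ e'.symm u := he's.contDiffAt (e'.open_target.mem_nhds (hδt hu))
    refine ⟨⟨hιs z (hDZ z hz), ?_⟩, hfι z (hDZ z hz), hθ, (hιc z (hDZ z hz)).comp u he'c,
      fun a b => ?_⟩
    · show P (ι z) ∈ e'.source ∩ e' ⁻¹' Metric.ball 0 δ
      rw [hPι z (hDZ z hz)]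
      exact ⟨hzs, by rw [mem_preimage, hr]; exact hu⟩
    · have h1 : HasFDerivAt e'.symm (T z : ℝ × ℝ →L[ℝ] ℝ × ℝ) u := by
        have := e'.hasFDerivAt_symm (f' := (T z).symm) (hδt hu)
          (by rw [← hzu, ← hβT z hz, he']; exact hh₀ z hz)
        simpa using this
      have h2 : HasFDerivAt (ι ∘ e'.symm) ((fderiv ℝ ι z).comp (T z : ℝ × ℝ →L[ℝ] ℝ × ℝ)) u :=
        ((hιc z (hDZ z hz)).differentiableAt (by simp)).hasFDerivAt.comp u h1
      rw [h2.fderiv]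
      show fderiv ℝ ι z ((T z : ℝ × ℝ →L[ℝ] ℝ × ℝ) (a, b)) = _
      rw [hT z hz, hA, map_add, map_smul, map_smul, hιr z (hDZ z hz), hιx z (hDZ z hz)]
      rfl
  · rintro y ⟨hy1, hy2, hy3⟩ hfy
    have hey' : e y = (P y, c) := by rw [heK, ← hfy]
    refine ⟨?_, ?_⟩
    · rw [← he']; exact hy3
    · show ι (e'.symm (h₀ (P y))) = y
      rw [← he', e'.left_inv hy2]
      show e.symm (P y, c) = y
      rw [← hey', e.left_inv hy1]

end Leaf

/-! ### Flow charts on the manifold. -/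

section Parametrization

variable {M : Type*} [TopologicalSpace M] [ChartedSpace E3 M] [IsManifold (𝓡 3) ∞ M]

/-- A parametrization of the level set of `f` through `p` by the flows of `R` and `X`. -/
structure IsFlowChart (R X : VField M) (f : M → ℝ) (p : M) (δ : ℝ) (G : ℝ × ℝ → M)
    (θ : M → ℝ × ℝ) (U : Set M) : Prop where
  pos : 0 < δ
  isOpen : IsOpen U
  mem : p ∈ U
  apply_self : θ p = 0
  apply_zero : G 0 = p
  continuousOn : ContinuousOn θ U
  level : ∀ u ∈ Metric.ball (0 : ℝ × ℝ) δ, f (G u) = f p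
  left_inv : ∀ u ∈ Metric.ball (0 : ℝ × ℝ) δ, θ (G u) = u
  smoothAt : ∀ u ∈ Metric.ball (0 : ℝ × ℝ) δ, ContMDiffAt 𝓘(ℝ, ℝ × ℝ) (𝓡 3) ∞ G u
  deriv : ∀ u ∈ Metric.ball (0 : ℝ × ℝ) δ, ∀ a b : ℝ,
    mfderiv 𝓘(ℝ, ℝ × ℝ) (𝓡 3) G u ((a, b) : ℝ × ℝ) = a • R (G u) + b • X (G u)
  mem_ball : ∀ q ∈ U, f q = f p → θ q ∈ Metric.ball (0 : ℝ × ℝ) δ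
  right_inv : ∀ q ∈ U, f q = f p → G (θ q) = q

theorem mfderiv_chart_symm_comb {p₀ : M} {y : E3} (hy : y ∈ (extChartAt (𝓡 3) p₀).target)
    (U V : VField M) (a b : ℝ) :
    mfderiv 𝓘(ℝ, E3) (𝓡 3) (extChartAt (𝓡 3) p₀).symm y
      (a • chartField p₀ U y + b • chartField p₀ V y : E3) =
      a • U ((extChartAt (𝓡 3) p₀).symm y) + b • V ((extChartAt (𝓡 3) p₀).symm y) := by
  rw [← mfderiv_chart_symm_chartField hy U, ← mfderiv_chart_symm_chartField hy V]
  set T := mfderiv 𝓘(ℝ, E3) (𝓡 3) (extChartAt (𝓡 3) p₀).symm y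
  have h1 := T.map_add (a • chartField p₀ U y) (b • chartField p₀ V y)
  have h2 := T.map_smul a (chartField p₀ U y)
  have h3 := T.map_smul b (chartField p₀ V y)
  exact h1.trans (congrArg₂ _ h2 h3)

theorem exists_isFlowChart {R X : VField M} (hR : ∀ q, SmoothAt R q) (hX : ∀ q, SmoothAt X q)
    {f : M → ℝ} (hf : ∀ q, ContMDiffAt (𝓡 3) 𝓘(ℝ, ℝ) ∞ f q)
    (hRX : ∀ q, mlieBracket (𝓡 3) R X q = 0) (hfR : ∀ q, mvfderiv (𝓡 3) f q (R q) = 0)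
    (hfX : ∀ q, mvfderiv (𝓡 3) f q (X q) = 0) {p : M} (hfp : mvfderiv (𝓡 3) f p ≠ 0)
    (hli : ∀ a b : ℝ, a • R p + b • X p = 0 → a = 0 ∧ b = 0) :
    ∃ δ G θ U, IsFlowChart R X f p δ G θ U := by
  set c := extChartAt (𝓡 3) p with hc
  have hp : p ∈ c.source := mem_extChartAt_source p
  have hcp : c p ∈ c.target := mem_extChartAt_target p
  have hcsp : c.symm (c p) = p := extChartAt_to_inv p
  have hfd : ∀ q, MDifferentiableAt (𝓡 3) 𝓘(ℝ, ℝ) f q := fun q => (hf q).mdifferentiableAt (by simp)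
  obtain ⟨δ, G, θ, U, hδ, hU, hpU, hUΩ, hθ0, hG0, hθc, h1, h2⟩ := exists_commuting_parametrization
    (V := chartField p R) (W := chartField p X) (f := f ∘ c.symm) (Ω := c.target) (y₀ := c p)
    (isOpen_chartTarget p) hcp (fun y hy => (contDiffAt_chartField hy (hR _)).contDiffWithinAt)
    (fun y hy => (contDiffAt_chartField hy (hX _)).contDiffWithinAt)
    (fun y hy => ((hf _).comp y (contMDiffAt_chart_symm hy)).contDiffAt.contDiffWithinAt)
    (fun y hy => by
      rw [lieBracket_chartField hy (hR _).diffAt (hX _).diffAt, chartField, mpullback_apply, hRX]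
      exact map_zero _)
    (fun y hy => by rw [← mvfderiv_chart_symm hy (hfd _), hfR])
    (fun y hy => by rw [← mvfderiv_chart_symm hy (hfd _), hfX])
    (by
      intro h0
      refine hfp ?_
      ext v
      have h3 := mvfderiv_chart_symm hcp (hfd _) (ext v)
      rw [h0] at h3
      rw [← hc, hcsp, ext_self] at h3
      exact h3)
    (fun a b hab => by
      refine hli a b ?_
      have h3 := congrArg (mfderiv 𝓘(ℝ, E3) (𝓡 3) c.symm (c p)) hab
      have h4 := mfderiv_chart_symm_comb hcp R X a b
      rw [← hc, hcsp] at h4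
      exact h4.symm.trans (h3.trans (map_zero _)))
  have hmem : ∀ u ∈ Metric.ball (0 : ℝ × ℝ) δ, G u ∈ c.target := fun u hu => hUΩ (h1 u hu).1
  refine ⟨δ, c.symm ∘ G, θ ∘ c, c.source ∩ c ⁻¹' U, hδ, ?_, ⟨hp, hpU⟩, hθ0, ?_, ?_, ?_, ?_, ?_,
    ?_, ?_, ?_⟩
  · exact (continuousOn_extChartAt p).isOpen_inter_preimage (isOpen_extChartAt_source p) hU
  · rw [Function.comp_apply, hG0, hcsp]
  · exact hθc.comp ((continuousOn_extChartAt p).mono inter_subset_left) fun q hq => hq.2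
  · intro u hu
    have := (h1 u hu).2.1
    rw [Function.comp_apply, Function.comp_apply, hcsp] at this
    exact this
  · intro u hu
    rw [Function.comp_apply, Function.comp_apply, c.right_inv (hmem u hu)]
    exact (h1 u hu).2.2.1
  · intro u hu
    exact (contMDiffAt_chart_symm (hmem u hu)).comp u (h1 u hu).2.2.2.1.contMDiffAt
  · intro u hu a b
    have hd := (h1 u hu).2.2.2.1.differentiableAt (by simp)
    rw [mfderiv_comp u ((contMDiffAt_chart_symm (hmem u hu)).mdifferentiableAt (by simp))
      hd.mdifferentiableAt, mfderiv_eq_fderiv]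
    have h3 := (h1 u hu).2.2.2.2 a b
    have h4 := congrArg (mfderiv 𝓘(ℝ, E3) (𝓡 3) c.symm (G u)) h3
    exact h4.trans (mfderiv_chart_symm_comb (hmem u hu) R X a b)
  · rintro q ⟨hq1, hq2⟩ hfq
    refine (h2 _ hq2 ?_).1
    rw [Function.comp_apply, Function.comp_apply, c.left_inv hq1, hcsp, hfq]
  · rintro q ⟨hq1, hq2⟩ hfq
    rw [Function.comp_apply, Function.comp_apply, (h2 _ hq2 ?_).2, c.left_inv hq1]
    rw [Function.comp_apply, Function.comp_apply, c.left_inv hq1, hcsp, hfq]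

end Parametrization

/-! ### From local to global actions; uniqueness of flow maps. -/

section Action

/-- A local action of a normed space extends to a global action. -/
theorem exists_global_action {V S : Type*} [NormedAddCommGroup V] [NormedSpace ℝ V]
    {φ : V → S → S} {ε : ℝ} (hε : 0 < ε) (h0 : φ 0 = id)
    (hφ : ∀ u ∈ Metric.ball (0 : V) ε, ∀ w ∈ Metric.ball (0 : V) ε, φ (u + w) = φ u ∘ φ w) :
    ∃ g : V → S → S, (∀ u w, g (u + w) = g u ∘ g w) ∧ ∀ u ∈ Metric.ball (0 : V) ε, g u = φ u := by
  simp only [mem_ball_zero_iff] at *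
  have hk : ∀ (k : ℕ) (w : V), k * ‖w‖ < ε → φ (k • w) = (φ w)^[k] := by
    intro k
    induction k with
    | zero => intro w _; simp [h0]
    | succ k ih =>
      intro w hw
      push_cast at hw
      have hw0 := norm_nonneg w
      have hk0 : (0 : ℝ) ≤ k * ‖w‖ := by positivity
      have hkw : ‖k • w‖ ≤ k * ‖w‖ := norm_nsmul_le
      rw [add_smul, one_smul, hφ _ (by linarith) _ (by linarith), ih w (by linarith),
        Function.iterate_succ]
  -- The global action is `g v = φ(v/n)^n` for large `n`. Independence of `n` follows by comparing
  -- `n` and `m` with their product.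
  have hind : ∀ (v : V) (n m : ℕ), 0 < n → 0 < m → ‖v‖ < n * ε → ‖v‖ < m * ε →
      (φ ((n : ℝ)⁻¹ • v))^[n] = (φ ((m : ℝ)⁻¹ • v))^[m] := by
    have aux : ∀ (v : V) (n m : ℕ), 0 < n → 0 < m → ‖v‖ < n * ε →
        (φ ((n : ℝ)⁻¹ • v))^[n] = (φ (((m * n : ℕ) : ℝ)⁻¹ • v))^[m * n] := by
      intro v n m hn hm hv
      have hn' : (0 : ℝ) < n := by exact_mod_cast hn
      have hm' : (0 : ℝ) < m := by exact_mod_cast hm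
      rw [Function.iterate_mul, ← hk m]
      · congr 2
        rw [← Nat.cast_smul_eq_nsmul ℝ, smul_smul]
        congr 1
        push_cast
        field_simp
      · rw [norm_smul, norm_inv, Real.norm_natCast]
        push_cast
        have : (m : ℝ) * ((m * n : ℝ)⁻¹ * ‖v‖) = ‖v‖ / n := by field_simp
        rw [this, div_lt_iff₀ hn']
        linarith
    intro v n m hn hm hv hv'
    rw [aux v n m hn hm hv, aux v m n hm hn hv', mul_comm]
  choose N hN using fun v : V => exists_nat_gt (‖v‖ / ε)
  have hN0 : ∀ v, 0 < N v := fun v => by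
    have : (0 : ℝ) < N v := lt_of_le_of_lt (by positivity) (hN v)
    exact_mod_cast this
  have hNv : ∀ v, ‖v‖ < N v * ε := fun v => (div_lt_iff₀ hε).1 (hN v)
  let g : V → S → S := fun v => (φ ((N v : ℝ)⁻¹ • v))^[N v]
  have hg : ∀ (v : V) (n : ℕ), 0 < n → ‖v‖ < n * ε → g v = (φ ((n : ℝ)⁻¹ • v))^[n] :=
    fun v n hn hv => hind v _ n (hN0 v) hn (hNv v) hv
  refine ⟨g, fun u w => ?_, fun u hu => ?_⟩
  · set n := N u + N w with hn
    have hn0 : 0 < n := by have := hN0 u; omega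
    have hn' : (0 : ℝ) < n := by exact_mod_cast hn0
    have hcast : (n : ℝ) = N u + N w := by rw [hn]; push_cast; rfl
    have hu := hNv u
    have hw := hNv w
    have hNu : (0 : ℝ) ≤ N u * ε := by positivity
    have hNw : (0 : ℝ) ≤ N w * ε := by positivity
    have hu' : ‖u‖ < n * ε := by rw [hcast]; linarith
    have hw' : ‖w‖ < n * ε := by rw [hcast]; linarith
    have huw : ‖u + w‖ < n * ε := by
      rw [hcast]; exact lt_of_le_of_lt (norm_add_le u w) (by linarith)
    have hball : ∀ v : V, ‖v‖ < n * ε → ‖(n : ℝ)⁻¹ • v‖ < ε := fun v hv => by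
      rw [norm_smul, norm_inv, Real.norm_natCast, inv_mul_lt_iff₀ hn']; exact hv
    have e1 := hφ _ (hball u hu') _ (hball w hw')
    have e2 := hφ _ (hball w hw') _ (hball u hu')
    rw [hg _ n hn0 huw, hg _ n hn0 hu', hg _ n hn0 hw', smul_add, e1]
    -- The small steps commute because addition does, so the power of the composite is the composite
    -- of the powers.
    refine Function.Commute.comp_iterate ?_ n
    intro q
    have := congrFun (e1.symm.trans ((congrArg φ (add_comm _ _)).trans e2)) q
    exact this
  · rw [hg u 1 one_pos (by simpa using hu)]
    simp

variable {M : Type*} [TopologicalSpace M] [ChartedSpace E3 M] [IsManifold (𝓡 3) ∞ M]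

/-- The map `F` is smooth at `u` and its coordinate fields there are `R` and `X`. -/
def IsFlowAt (R X : VField M) (F : ℝ × ℝ → M) (u : ℝ × ℝ) : Prop :=
  ContMDiffAt 𝓘(ℝ, ℝ × ℝ) (𝓡 3) ∞ F u ∧ ∀ a b : ℝ,
    mfderiv 𝓘(ℝ, ℝ × ℝ) (𝓡 3) F u ((a, b) : ℝ × ℝ) = a • R (F u) + b • X (F u)

/-- A smooth map from a ball in `ℝ × ℝ` whose coordinate fields are `R` and `X`. -/
def IsFlowMap (R X : VField M) (F : ℝ × ℝ → M) (r : ℝ) : Prop :=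
  ∀ u ∈ Metric.ball (0 : ℝ × ℝ) r, IsFlowAt R X F u

variable {R X : VField M}

theorem IsFlowAt.congr {F F' : ℝ × ℝ → M} {u : ℝ × ℝ} (h : IsFlowAt R X F u)
    (hF : F' =ᶠ[𝓝 u] F) : IsFlowAt R X F' u := by
  refine ⟨h.1.congr_of_eventuallyEq hF, fun a b => ?_⟩
  have h1 : ∀ q, q = F u → (a • R q + b • X q : E3) = (a • R (F u) + b • X (F u) : E3) := by
    rintro _ rfl; rfl
  have h2 := congrArg (fun T : ℝ × ℝ →L[ℝ] E3 => T (a, b))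
    (hF.mfderiv_eq (I := 𝓘(ℝ, ℝ × ℝ)) (I' := 𝓡 3))
  exact h2.trans ((h.2 a b).trans (h1 _ hF.self_of_nhds).symm)

theorem IsFlowAt.translate {F : ℝ × ℝ → M} {w u : ℝ × ℝ} (h : IsFlowAt R X F (w + u)) :
    IsFlowAt R X (fun u => F (w + u)) u := by
  obtain ⟨h1, h2⟩ := h
  have ht : HasFDerivAt (fun u : ℝ × ℝ => w + u) (ContinuousLinearMap.id ℝ (ℝ × ℝ)) u :=
    (hasFDerivAt_id u).const_add w
  have htc : ContDiffAt ℝ ∞ (fun u : ℝ × ℝ => w + u) u := contDiffAt_const.add contDiffAt_id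
  refine ⟨ContMDiffAt.comp u (g := F) h1 htc.contMDiffAt, fun a b => ?_⟩
  have hm : HasMFDerivAt 𝓘(ℝ, ℝ × ℝ) (𝓡 3) (F ∘ fun u => w + u) u _ :=
    HasMFDerivAt.comp u (g := F) (h1.mdifferentiableAt (by simp)).hasMFDerivAt ht.hasMFDerivAt
  have := hm.mfderiv
  rw [show (fun u => F (w + u)) = F ∘ fun u => w + u from rfl, this]
  exact h2 a b

theorem IsFlowMap.mono {F : ℝ × ℝ → M} {r r' : ℝ} (h : IsFlowMap R X F r) (hr : r' ≤ r) :
    IsFlowMap R X F r' := fun u hu => h u (Metric.ball_subset_ball hr hu)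

theorem IsFlowMap.translate {F : ℝ × ℝ → M} {r r' : ℝ} (h : IsFlowMap R X F r) {w : ℝ × ℝ}
    (hw : ‖w‖ + r' ≤ r) : IsFlowMap R X (fun u => F (w + u)) r' := by
  intro u hu
  rw [mem_ball_zero_iff] at hu
  refine (h (w + u) ?_).translate
  rw [mem_ball_zero_iff]
  exact lt_of_le_of_lt (norm_add_le w u) (by linarith)

/-- Along the ray through `u` both maps are integral curves of `u.1 R + u.2 X` with the same
starting point. -/
theorem IsFlowMap.eqOn [T2Space M] (hR : ∀ q, SmoothAt R q) (hX : ∀ q, SmoothAt X q)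
    {F F' : ℝ × ℝ → M} {r : ℝ} (h : IsFlowMap R X F r) (h' : IsFlowMap R X F' r)
    (h0 : F 0 = F' 0) : EqOn F F' (Metric.ball 0 r) := by
  intro u hu
  rw [mem_ball_zero_iff] at hu
  -- Room beyond time `1`, so that `u` lies inside an open interval of the ray.
  obtain ⟨s, hs1, hs⟩ : ∃ s : ℝ, 1 < s ∧ s * ‖u‖ < r := by
    have hc : ContinuousAt (fun s : ℝ => s * ‖u‖) 1 := by fun_prop
    have := hc.eventually_lt_const (u := r) (by simpa using hu)
    have h1 := (this.filter_mono (nhdsWithin_le_nhds (s := Ioi 1))).and self_mem_nhdsWithin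
    obtain ⟨s, hs⟩ := h1.exists
    exact ⟨s, hs.2, hs.1⟩
  have hcurve : ∀ {H : ℝ × ℝ → M}, IsFlowMap R X H r → IsMIntegralCurveOn (fun t : ℝ => H (t • u))
      (fun q => u.1 • R q + u.2 • X q) (Ioo (-s) s) := by
    intro H hH t ht
    have htu : t • u ∈ Metric.ball (0 : ℝ × ℝ) r := by
      rw [mem_ball_zero_iff, norm_smul, Real.norm_eq_abs]
      exact lt_of_le_of_lt (mul_le_mul_of_nonneg_right (abs_lt.2 ht).le (norm_nonneg u)) hs
    obtain ⟨h1, h2⟩ := hH _ htu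
    have hd : HasFDerivAt (fun t : ℝ => t • u) ((1 : ℝ →L[ℝ] ℝ).smulRight u) t :=
      (hasFDerivAt_id t).smul_const u
    have hm : HasMFDerivAt 𝓘(ℝ, ℝ) (𝓡 3) (H ∘ fun t : ℝ => t • u) t _ :=
      HasMFDerivAt.comp t (g := H) (h1.mdifferentiableAt (by simp)).hasMFDerivAt hd.hasMFDerivAt
    have h4 : ((1 : ℝ →L[ℝ] ℝ).smulRight (u.1 • R (H (t • u)) + u.2 • X (H (t • u))) :
        ℝ →L[ℝ] TangentSpace (𝓡 3) (H (t • u))) =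
        (mfderiv 𝓘(ℝ, ℝ × ℝ) (𝓡 3) H (t • u)).comp ((1 : ℝ →L[ℝ] ℝ).smulRight u) := by
      refine ContinuousLinearMap.ext_ring ?_
      rw [← h2 u.1 u.2]
      simp only [ContinuousLinearMap.smulRight_apply, one_apply_eq_self, one_smul]
      exact congrArg _ (one_smul ℝ u).symm
    refine HasMFDerivAt.hasMFDerivWithinAt ?_
    have h5 : HasMFDerivAt 𝓘(ℝ, ℝ) (𝓡 3) (fun t : ℝ => H (t • u)) t
        ((1 : ℝ →L[ℝ] ℝ).smulRight (u.1 • R (H (t • u)) + u.2 • X (H (t • u)))) := by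
      rw [h4]; exact hm
    exact h5
  have : IsManifold (𝓡 3) 1 M := IsManifold.of_le (n := ∞) (by simp)
  have hv : ContMDiff (𝓡 3) ((𝓡 3).prod 𝓘(ℝ, E3)) 1
      (fun q => Bundle.TotalSpace.mk' E3 (E := fun q : M => TangentSpace (𝓡 3) q) q
        (u.1 • R q + u.2 • X q)) := fun q =>
    (ContMDiffAt.add_section ((hR q).const_smul_section (a := u.1))
      ((hX q).const_smul_section (a := u.2))).of_le (by simp)
  have := isMIntegralCurveOn_Ioo_eqOn_of_contMDiff_boundaryless (t₀ := 0) (a := -s) (b := s)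
    ⟨by linarith, by linarith⟩ hv (hcurve h) (hcurve h') (by simpa using h0)
    (show (1 : ℝ) ∈ Ioo (-s) s from ⟨by linarith, hs1⟩)
  simpa using this

end Action

/-! ### The action of the plane on a compact level set. -/

section LevelAction

variable {M : Type*} [TopologicalSpace M] [ChartedSpace E3 M] [IsManifold (𝓡 3) ∞ M]
variable {R X : VField M} {f : M → ℝ}

theorem IsFlowChart.isFlowMap {p : M} {δ : ℝ} {G : ℝ × ℝ → M} {θ : M → ℝ × ℝ} {U : Set M}
    (h : IsFlowChart R X f p δ G θ U) : IsFlowMap R X G δ :=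
  fun u hu => ⟨h.smoothAt u hu, h.deriv u hu⟩

/-- On a compact level set covered by flow charts the flows exist for a uniform time. -/
theorem exists_uniform_flow {c : ℝ} (hc : IsCompact (f ⁻¹' {c}))
    (hch : ∀ p ∈ f ⁻¹' {c}, ∃ δ G θ U, IsFlowChart R X f p δ G θ U) :
    ∃ ε > 0, ∀ q ∈ f ⁻¹' {c}, ∃ F : ℝ × ℝ → M, F 0 = q ∧ IsFlowMap R X F ε ∧
      ∀ u ∈ Metric.ball (0 : ℝ × ℝ) ε, F u ∈ f ⁻¹' {c} := by
  refine hc.induction_on (p := fun A => ∃ ε > 0, ∀ q ∈ A, q ∈ f ⁻¹' {c} → ∃ F : ℝ × ℝ → M,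
    F 0 = q ∧ IsFlowMap R X F ε ∧ ∀ u ∈ Metric.ball (0 : ℝ × ℝ) ε, F u ∈ f ⁻¹' {c})
    ⟨1, one_pos, by simp⟩ ?_ ?_ ?_ |>.imp fun ε h => ⟨h.1, fun q hq => h.2 q hq hq⟩
  · rintro s t hst ⟨ε, hε, h⟩
    exact ⟨ε, hε, fun q hq => h q (hst hq)⟩
  · rintro s t ⟨ε, hε, h⟩ ⟨ε', hε', h'⟩
    refine ⟨min ε ε', lt_min hε hε', fun q hq hqc => ?_⟩
    rcases hq with hq | hq
    · obtain ⟨F, h1, h2, h3⟩ := h q hq hqc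
      exact ⟨F, h1, h2.mono (min_le_left _ _),
        fun u hu => h3 u (Metric.ball_subset_ball (min_le_left _ _) hu)⟩
    · obtain ⟨F, h1, h2, h3⟩ := h' q hq hqc
      exact ⟨F, h1, h2.mono (min_le_right _ _),
        fun u hu => h3 u (Metric.ball_subset_ball (min_le_right _ _) hu)⟩
  · intro p hp
    obtain ⟨δ, G, θ, U, h⟩ := hch p hp
    have hδ := h.pos
    -- Points with coordinate within `δ / 2` of the origin can still move by `δ / 2` inside the
    -- chart; the flow from `q` is `G` translated by `θ q`.
    refine ⟨U ∩ θ ⁻¹' Metric.ball 0 (δ / 2), mem_nhdsWithin_of_mem_nhds ?_, δ / 2, by positivity,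
      fun q hq hqc => ⟨fun u => G (θ q + u), ?_, ?_, fun u hu => ?_⟩⟩
    · refine (h.continuousOn.isOpen_inter_preimage h.isOpen Metric.isOpen_ball).mem_nhds
        ⟨h.mem, ?_⟩
      rw [mem_preimage, h.apply_self]
      exact Metric.mem_ball_self (by positivity)
    · show G (θ q + 0) = q
      rw [add_zero]
      exact h.right_inv q hq.1 (hqc.trans hp.symm)
    · refine h.isFlowMap.translate ?_
      have := mem_ball_zero_iff.1 hq.2
      linarith
    · refine (h.level _ ?_).trans hp
      rw [mem_ball_zero_iff] at *
      have := mem_ball_zero_iff.1 hq.2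
      exact lt_of_le_of_lt (norm_add_le _ _) (by linarith)

/-- The commuting flows of `R` and `X` define an action of `ℝ × ℝ` on a compact level set. -/
theorem exists_flow_action [T2Space M] (hR : ∀ q, SmoothAt R q) (hX : ∀ q, SmoothAt X q)
    {c : ℝ} (hc : IsCompact (f ⁻¹' {c}))
    (hch : ∀ p ∈ f ⁻¹' {c}, ∃ δ G θ U, IsFlowChart R X f p δ G θ U) :
    ∃ g : ℝ × ℝ → f ⁻¹' {c} → f ⁻¹' {c}, (∀ q, g 0 q = q) ∧
      (∀ u w q, g (u + w) q = g u (g w q)) ∧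
      ∀ q v, IsFlowAt R X (fun u => (g u q : M)) v := by
  obtain ⟨ε, hε, h⟩ := exists_uniform_flow hc hch
  choose! F hF0 hF hFc using h
  classical
  -- The value outside the ball is arbitrary. Additivity is claimed only for arguments of norm below
  -- `ε / 2`, whose sums stay in the ball.
  let φ : ℝ × ℝ → f ⁻¹' {c} → f ⁻¹' {c} := fun u q =>
    if hu : u ∈ Metric.ball (0 : ℝ × ℝ) ε then ⟨F q u, hFc q q.2 u hu⟩ else q
  have hφF : ∀ u ∈ Metric.ball (0 : ℝ × ℝ) ε, ∀ q, (φ u q : M) = F q u := fun u hu q => by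
    simp only [φ, dif_pos hu]
  have h0ε : (0 : ℝ × ℝ) ∈ Metric.ball (0 : ℝ × ℝ) ε := Metric.mem_ball_self hε
  have hφ0 : φ 0 = id := funext fun q => Subtype.ext (by rw [hφF 0 h0ε, hF0 q q.2]; rfl)
  have hε2 : (0 : ℝ) < ε / 2 := by positivity
  have hsub : ∀ u ∈ Metric.ball (0 : ℝ × ℝ) (ε / 2), u ∈ Metric.ball (0 : ℝ × ℝ) ε := fun u hu =>
    Metric.ball_subset_ball (by linarith) hu
  obtain ⟨g, hg, hgφ⟩ := exists_global_action (φ := φ) hε2 hφ0 (fun u hu w hw => by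
    funext q
    refine Subtype.ext ?_
    have hu' := mem_ball_zero_iff.1 hu
    have hw' := mem_ball_zero_iff.1 hw
    have huw : w + u ∈ Metric.ball (0 : ℝ × ℝ) ε := by
      rw [mem_ball_zero_iff]
      exact lt_of_le_of_lt (norm_add_le _ _) (by linarith)
    rw [add_comm, hφF _ huw, Function.comp_apply, hφF _ (hsub u hu)]
    have h1 : IsFlowMap R X (fun u => F q (w + u)) (ε / 2) := (hF q q.2).translate (by linarith)
    have h2 := (hF (φ w q) (φ w q).2).mono (show ε / 2 ≤ ε by linarith)
    refine h1.eqOn hR hX h2 ?_ hu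
    rw [hF0 _ (φ w q).2, hφF _ (hsub w hw), add_zero])
  refine ⟨g, fun q => ?_, fun u w q => by rw [hg]; rfl, fun q v => ?_⟩
  · rw [hgφ 0 (Metric.mem_ball_self hε2), hφ0]; rfl
  -- Near `v`, additivity writes `g u q` as the local flow from `g v q` for time `u - v`.
  · have h1 : IsFlowAt R X (F (g v q)) (-v + v) := by
      rw [neg_add_cancel]
      exact hF _ (g v q).2 0 h0ε
    refine h1.translate.congr ?_
    have hball : ∀ᶠ u in 𝓝 v, -v + u ∈ Metric.ball (0 : ℝ × ℝ) (ε / 2) := by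
      refine ContinuousAt.eventually_mem (by fun_prop) ?_
      rw [neg_add_cancel]
      exact Metric.ball_mem_nhds _ hε2
    filter_upwards [hball] with u hu
    rw [← hφF _ (hsub _ hu), ← hgφ _ hu, ← Function.comp_apply (f := g (-v + u)), ← hg,
      neg_add_cancel_comm]

end LevelAction

/-! ### Immersions and embeddings of surfaces. -/

section Immersion

variable {M : Type*} [TopologicalSpace M] [ChartedSpace E3 M] [IsManifold (𝓡 3) ∞ M]

/-- A smooth map from a surface with injective derivative at a point is an immersion there. -/
theorem isImmersionAtOfComplement_of_injective_mfderiv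
    {E H N : Type*} [NormedAddCommGroup E] [NormedSpace ℝ E] [FiniteDimensional ℝ E]
    [TopologicalSpace H] {I : ModelWithCorners ℝ E H} [I.Boundaryless]
    [TopologicalSpace N] [ChartedSpace H N] [IsManifold I ∞ N]
    (hE : Module.finrank ℝ E = 2) {f : N → M} (hf : ContMDiff I (𝓡 3) ∞ f) {x : N}
    (hinj : Function.Injective (mfderiv I (𝓡 3) f x)) :
    Manifold.IsImmersionAtOfComplement ℝ I (𝓡 3) ∞ f x := by
  set φ := extChartAt I x with hφ
  set c := extChartAt (𝓡 3) (f x) with hc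
  let g : E → E3 := c ∘ f ∘ φ.symm
  set u₀ := φ x with hu₀
  let Ω₀ : Set E := φ.target ∩ φ.symm ⁻¹' (f ⁻¹' c.source)
  have hΩ₀ : IsOpen Ω₀ := (continuousOn_extChartAt_symm x).isOpen_inter_preimage
    (isOpen_extChartAt_target x) ((isOpen_extChartAt_source (f x)).preimage hf.continuous)
  have hu₀t : u₀ ∈ φ.target := mem_extChartAt_target x
  have hsymm : φ.symm u₀ = x := extChartAt_to_inv x
  have hu₀Ω : u₀ ∈ Ω₀ := ⟨hu₀t, by
    rw [mem_preimage, mem_preimage, hsymm]; exact mem_extChartAt_source (f x)⟩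
  have hg : ContDiffOn ℝ ∞ g Ω₀ := by
    rw [← contMDiffOn_iff_contDiffOn]
    refine (contMDiffOn_extChartAt (I := 𝓡 3) (x := f x)).comp
      ((hf.comp_contMDiffOn (contMDiffOn_extChartAt_symm x)).mono inter_subset_left) ?_
    intro u hu
    have h1 : f (φ.symm u) ∈ c.source := hu.2
    rw [hc, extChartAt_source] at h1
    exact h1
  have hgd : HasFDerivAt g (fderiv ℝ g u₀) u₀ :=
    ((hg.contDiffAt (hΩ₀.mem_nhds hu₀Ω)).differentiableAt (by simp)).hasFDerivAt
  set D : E →L[ℝ] E3 := fderiv ℝ g u₀ with hD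
  have hDinj : Function.Injective D := by
    have h1 := (hf.mdifferentiableAt (x := x) (by simp)).mfderiv
    rw [I.range_eq_univ, fderivWithin_univ] at h1
    have h2 : (mfderiv I (𝓡 3) f x : E →L[ℝ] E3) = D := h1
    rw [← h2]; exact hinj
  obtain ⟨ν, hν⟩ : ∃ ν, ν ∉ LinearMap.range D.toLinearMap := by
    by_contra! h
    have h1 : LinearMap.range D.toLinearMap = ⊤ := Submodule.eq_top_iff'.2 h
    have h2 := LinearMap.finrank_range_of_inj (f := D.toLinearMap) hDinj
    rw [h1, finrank_top, hE, finrank_euclideanSpace_fin] at h2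
    norm_num at h2
  let L : E × ℝ →L[ℝ] E3 := D.coprod ((1 : ℝ →L[ℝ] ℝ).smulRight ν)
  have hL : ∀ u t, L (u, t) = D u + t • ν := fun u t => by simp [L]
  have hLinj : Function.Injective L := by
    rw [injective_iff_map_eq_zero]
    rintro ⟨u, t⟩ hut
    rw [hL] at hut
    have ht : t = 0 := by
      by_contra ht
      refine hν ⟨-(t⁻¹ • u), ?_⟩
      have : t • ν = - D u := by rw [eq_neg_iff_add_eq_zero, add_comm]; exact hut
      show D (-(t⁻¹ • u)) = ν
      rw [map_neg, map_smul, ← smul_neg, ← this, smul_smul, inv_mul_cancel₀ ht, one_smul]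
    rw [ht, zero_smul, add_zero] at hut
    rw [ht, Prod.mk_eq_zero]
    exact ⟨hDinj (hut.trans (map_zero D).symm), rfl⟩
  let e : (E × ℝ) ≃L[ℝ] E3 := (LinearMap.linearEquivOfInjective L.toLinearMap hLinj
    (by simp [hE])).toContinuousLinearEquiv
  have he : ∀ u t, e (u, t) = D u + t • ν := hL
  let pr₁ : E3 →L[ℝ] E := (ContinuousLinearMap.fst ℝ E ℝ).comp (e.symm : E3 →L[ℝ] E × ℝ)
  let pr₂ : E3 →L[ℝ] ℝ := (ContinuousLinearMap.snd ℝ E ℝ).comp (e.symm : E3 →L[ℝ] E × ℝ)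
  have hpr : ∀ y, D (pr₁ y) + pr₂ y • ν = y := fun y => by
    rw [← he]; exact e.apply_symm_apply y
  have hpr₁ : ∀ u, pr₁ (e (u, 0)) = u := fun u => by simp [pr₁]
  have hpr₂ : ∀ u, pr₂ (e (u, 0)) = 0 := fun u => by simp [pr₂]
  -- Thickening the surface in a direction `ν` transverse to the image of `D` gives a map with
  -- derivative the identity at the base point. Its local inverse straightens `g` to `u ↦ e (u, 0)`.
  let Ψ : E3 → E3 := fun y => g (pr₁ y) + pr₂ y • ν
  have hΨe : ∀ u, Ψ (e (u, 0)) = g u := fun u => by simp only [Ψ, hpr₁, hpr₂]; simp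
  have hΨ : ContDiffOn ℝ ∞ Ψ (pr₁ ⁻¹' Ω₀) :=
    (hg.comp pr₁.contDiff.contDiffOn (fun y hy => hy)).add
      (pr₂.contDiff.contDiffOn.smul contDiffOn_const)
  have hΨd : HasFDerivAt Ψ ((ContinuousLinearEquiv.refl ℝ E3 : E3 ≃L[ℝ] E3) : E3 →L[ℝ] E3)
      (e (u₀, 0)) := by
    have h1 : HasFDerivAt (g ∘ pr₁) (D.comp pr₁) (e (u₀, 0)) := by
      refine HasFDerivAt.comp _ ?_ pr₁.hasFDerivAt
      rw [hpr₁]; exact hgd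
    have h2 := h1.add ((pr₂.hasFDerivAt (x := e (u₀, 0))).smul_const ν)
    refine h2.congr_fderiv ?_
    ext1 y
    exact hpr y
  obtain ⟨ε, hεΨ, hεs, hεΩ, hεc⟩ := exists_local_diffeo (hΩ₀.preimage pr₁.continuous)
    (show e (u₀, 0) ∈ pr₁ ⁻¹' Ω₀ by rw [mem_preimage, hpr₁]; exact hu₀Ω) hΨ hΨd
  let s : Set N := φ.source ∩ φ ⁻¹' ((fun u => e (u, 0)) ⁻¹' ε.source)
  have hs : IsOpen s := (continuousOn_extChartAt x).isOpen_inter_preimage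
    (isOpen_extChartAt_source x) (ε.open_source.preimage (by fun_prop))
  let dom : OpenPartialHomeomorph N H := (chartAt H x).restr s
  let cod : OpenPartialHomeomorph M E3 := (chartAt E3 (f x)).trans ε.symm
  have hcu : c (f x) = ε (e (u₀, 0)) := by
    rw [hεΨ, hΨe]; show c (f x) = c (f (φ.symm u₀)); rw [hsymm]
  refine Manifold.IsImmersionAtOfComplement.mk_of_continuousAt hf.continuous.continuousAt e dom cod
    ?_ ?_ ?_ ?_ ?_
  · rw [OpenPartialHomeomorph.restr_source, hs.interior_eq]
    exact ⟨mem_chart_source H x, mem_extChartAt_source x, hεs⟩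
  · rw [OpenPartialHomeomorph.trans_source]
    refine ⟨mem_chart_source E3 (f x), ?_⟩
    show c (f x) ∈ ε.target
    rw [hcu]
    exact ε.map_source hεs
  · exact restr_mem_maximalAtlas (contDiffGroupoid ∞ I) (IsManifold.chart_mem_maximalAtlas x) hs
  · refine OpenPartialHomeomorph.mem_maximalAtlas_of_contMDiffOn _ ?_ ?_
    · refine ContMDiffOn.comp (t := ε.target) (contMDiffOn_iff_contDiffOn.2 hεc)
        ((contMDiffOn_chart (I := 𝓡 3) (n := ∞) (x := f x)).mono ?_) ?_
      · exact fun q hq => hq.1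
      · exact fun q hq => hq.2
    · have h1 : ContMDiffOn (𝓡 3) (𝓡 3) ∞ ε ε.source := by
        rw [hεΨ]; exact contMDiffOn_iff_contDiffOn.2 (hΨ.mono hεΩ)
      exact (contMDiffOn_chart_symm (I := 𝓡 3) (n := ∞) (x := f x)).comp
        (h1.mono fun y hy => hy.1) fun y hy => hy.2
  · intro u hu
    set q := (dom.extend I).symm u with hq
    have hqs : q ∈ dom.source := by
      rw [← dom.extend_source (I := I)]; exact (dom.extend I).map_target hu
    rw [OpenPartialHomeomorph.restr_source, hs.interior_eq] at hqs
    have hφq : φ q = u := (dom.extend I).right_inv hu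
    have hqu : φ.symm u = q := by rw [← hφq]; exact φ.left_inv hqs.2.1
    have hmem : e (u, 0) ∈ ε.source := by rw [← hφq]; exact hqs.2.2
    show ε.symm (c (f q)) = e (u, 0)
    rw [show c (f q) = g u by show _ = c (f (φ.symm u)); rw [hqu], ← hΨe, ← hεΨ, ε.left_inv hmem]

/-- A smooth injective map from a compact surface with injective derivative is an embedding. -/
theorem isSmoothEmbedding_of_injective [T2Space M]
    {E H N : Type*} [NormedAddCommGroup E] [NormedSpace ℝ E] [FiniteDimensional ℝ E]
    [TopologicalSpace H] {I : ModelWithCorners ℝ E H} [I.Boundaryless]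
    [TopologicalSpace N] [CompactSpace N] [ChartedSpace H N] [IsManifold I ∞ N]
    (hE : Module.finrank ℝ E = 2) {f : N → M} (hf : ContMDiff I (𝓡 3) ∞ f)
    (hinj : Function.Injective f) (hd : ∀ x, Function.Injective (mfderiv I (𝓡 3) f x)) :
    Manifold.IsSmoothEmbedding I (𝓡 3) ∞ f where
  isImmersion := ⟨ℝ, inferInstance, inferInstance, fun x =>
    isImmersionAtOfComplement_of_injective_mfderiv hE hf (hd x)⟩
  isEmbedding := (hf.continuous.isClosedEmbedding hinj).isEmbedding

end Immersion

/-! ### Lattices in the plane. -/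

section Lattice

/-- A discrete cocompact subgroup of the plane has a basis. -/
theorem exists_lattice_basis (Λ : Submodule ℤ (ℝ × ℝ)) {δ N : ℝ} (hδ : 0 < δ)
    (hdisc : ∀ u ∈ Λ, ‖u‖ < δ → u = 0) (hcoc : ∀ v, ∃ w, ‖w‖ < N ∧ v - w ∈ Λ) :
    ∃ b : Module.Basis (Fin 2) ℝ (ℝ × ℝ), ∀ v, v ∈ Λ ↔ ∃ m n : ℤ, v = (m : ℝ) • b 0 + (n : ℝ) • b 1 := by
  have hd : DiscreteTopology Λ := by
    refine (discreteTopology_iff_isOpen_singleton_zero (G := Λ)).2 ?_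
    rw [Metric.isOpen_iff]
    rintro x rfl
    refine ⟨δ, hδ, fun y hy => ?_⟩
    rw [mem_ball_zero_iff] at hy
    exact Subtype.ext (hdisc y y.2 hy)
  have hspan : Submodule.span ℝ (Λ : Set (ℝ × ℝ)) = ⊤ := by
    -- A nonzero functional `ℓ` vanishing on `Λ` would be bounded on the plane, since every vector
    -- is within `N` of `Λ`; large multiples of `v` contradict this.
    by_contra hne
    obtain ⟨ℓ, hℓ0, hℓ⟩ := Submodule.exists_le_ker_of_lt_top _ (lt_top_iff_ne_top.2 hne)
    obtain ⟨v, hv⟩ : ∃ v, ℓ v ≠ 0 := by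
      by_contra! h
      exact hℓ0 (LinearMap.ext h)
    let ℓ' := LinearMap.toContinuousLinearMap ℓ
    obtain ⟨k, hk⟩ := exists_nat_gt (‖ℓ'‖ * N / |ℓ v|)
    rw [div_lt_iff₀ (abs_pos.2 hv)] at hk
    obtain ⟨w, hw, hvw⟩ := hcoc ((k : ℝ) • v)
    have h1 : ℓ ((k : ℝ) • v - w) = 0 := hℓ (Submodule.subset_span hvw)
    rw [map_sub, map_smul, smul_eq_mul, sub_eq_zero] at h1
    have h2 : |ℓ w| ≤ ‖ℓ'‖ * ‖w‖ := ℓ'.le_opNorm w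
    rw [← h1, abs_mul, Nat.abs_cast] at h2
    have h3 : ‖ℓ'‖ * ‖w‖ ≤ ‖ℓ'‖ * N := by gcongr
    linarith
  have hZ : IsZLattice ℝ Λ := ⟨hspan⟩
  have hrank : Module.finrank ℤ Λ = 2 := by
    rw [ZLattice.rank ℝ Λ]; simp
  have hfree : Module.Free ℤ Λ := ZLattice.module_free ℝ Λ
  have hfin : Module.Finite ℤ Λ := ZLattice.module_finite ℝ Λ
  let b₀ := Module.finBasisOfFinrankEq ℤ Λ hrank
  refine ⟨b₀.ofZLatticeBasis ℝ Λ, fun v => ?_⟩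
  have h1 : ∀ v, v ∈ Λ ↔ v ∈ Submodule.span ℤ (range (b₀.ofZLatticeBasis ℝ Λ)) := fun v => by
    rw [Module.Basis.ofZLatticeBasis_span]
  rw [h1, Submodule.mem_span_range_iff_exists_fun]
  constructor
  · rintro ⟨c, rfl⟩
    exact ⟨c 0, c 1, by rw [Fin.sum_univ_two, Int.cast_smul_eq_zsmul, Int.cast_smul_eq_zsmul]⟩
  · rintro ⟨m, n, rfl⟩
    exact ⟨![m, n], by
      rw [Fin.sum_univ_two, Int.cast_smul_eq_zsmul, Int.cast_smul_eq_zsmul]; rfl⟩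

end Lattice

/-! ### Quotients of the plane as embedded tori. -/

section Torus

variable {M : Type*} [TopologicalSpace M] [ChartedSpace E3 M] [IsManifold (𝓡 3) ∞ M]
variable {R X : VField M}

/-- Dividing by `z₀` moves the base point to `1`, away from the branch cut of `arg`. -/
theorem contMDiffAt_arg_div (z₀ : Circle) :
    ContMDiffAt (𝓡 1) 𝓘(ℝ, ℝ) ∞ (fun z : Circle => Complex.arg (z / z₀ : Circle)) z₀ := by
  have : Fact (Module.finrank ℝ ℂ = 1 + 1) := ⟨Complex.finrank_real_complex⟩
  have h1 : ContMDiffAt (𝓡 1) (𝓡 1) ∞ (fun z : Circle => z / z₀) z₀ := by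
    have : LieGroup (𝓡 1) ∞ Circle := LieGroup.of_le (n := ω) le_top
    exact contMDiffAt_id.div contMDiffAt_const
  have h2 : ContMDiffAt (𝓡 1) 𝓘(ℝ, ℂ) ∞ (fun z : Circle => (z : ℂ)) (z₀ / z₀) :=
    (contMDiff_coe_sphere (E := ℂ) (n := 1)).contMDiffAt
  have h3 : ContDiffAt ℝ ∞ (fun z : ℂ => Complex.arg z) (((z₀ / z₀ : Circle)) : ℂ) := by
    have hs : (((z₀ / z₀ : Circle)) : ℂ) ∈ Complex.slitPlane := by
      rw [div_self', Circle.coe_one]; exact Complex.one_mem_slitPlane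
    have h4 := ((Complex.contDiffAt_log hs (n := ∞)).restrict_scalars ℝ)
    have h5 : (fun z : ℂ => Complex.arg z) = Complex.imCLM ∘ Complex.log :=
      funext fun z => (Complex.log_im z).symm
    rw [h5]
    exact Complex.imCLM.contDiff.contDiffAt.comp _ h4
  have h6 : ContMDiffAt (𝓡 1) 𝓘(ℝ, ℂ) ∞ (fun z : Circle => ((z / z₀ : Circle) : ℂ)) z₀ :=
    ContMDiffAt.comp (f := fun z : Circle => z / z₀) (g := fun z : Circle => (z : ℂ)) z₀ h2 h1
  exact ContMDiffAt.comp (f := fun z : Circle => ((z / z₀ : Circle) : ℂ)) (g := Complex.arg) z₀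
    h3.contMDiffAt h6

/-- A doubly periodic flow map descends to an embedding of the torus. -/
theorem exists_torus_embedding [T2Space M] {F : ℝ × ℝ → M} (hF : ∀ u, IsFlowAt R X F u)
    (hli : ∀ u, ∀ a b : ℝ, a • R (F u) + b • X (F u) = 0 → a = 0 ∧ b = 0)
    (b : Module.Basis (Fin 2) ℝ (ℝ × ℝ))
    (hb : ∀ u w, F u = F w ↔ ∃ m n : ℤ, u - w = (m : ℝ) • b 0 + (n : ℝ) • b 1) :
    ∃ T : Circle × Circle → M, Manifold.IsSmoothEmbedding ((𝓡 1).prod (𝓡 1)) (𝓡 3) ∞ T ∧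
      range T = range F := by
  -- Normalizes the period lattice to `2π ℤ²`, the kernel of `Circle.exp` in each factor.
  let L : ℝ × ℝ →L[ℝ] ℝ × ℝ := (2 * Real.pi)⁻¹ • ((ContinuousLinearMap.fst ℝ ℝ ℝ).smulRight (b 0) +
    (ContinuousLinearMap.snd ℝ ℝ ℝ).smulRight (b 1))
  have hL : ∀ u, L u = (2 * Real.pi)⁻¹ • (u.1 • b 0 + u.2 • b 1) := fun u => rfl
  have hπ : (2 * Real.pi) ≠ 0 := by positivity
  have hLinj : Function.Injective L := by
    rw [injective_iff_map_eq_zero]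
    intro u hu
    rw [hL, smul_eq_zero, or_iff_right (inv_ne_zero hπ)] at hu
    have h1 := Fintype.linearIndependent_iff.1 b.linearIndependent ![u.1, u.2]
      (by simpa [Fin.sum_univ_two] using hu)
    exact Prod.ext (h1 0) (h1 1)
  have hLsurj : Function.Surjective L := LinearMap.injective_iff_surjective.1 hLinj
  let Φ : ℝ × ℝ → M := fun u => F (L u)
  have hΦc : ContMDiff 𝓘(ℝ, ℝ × ℝ) (𝓡 3) ∞ Φ := fun u =>
    ContMDiffAt.comp u (hF (L u)).1 L.contDiff.contDiffAt.contMDiffAt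
  have hFinj : ∀ u, Function.Injective (mfderiv 𝓘(ℝ, ℝ × ℝ) (𝓡 3) F u) := fun u => by
    rw [injective_iff_map_eq_zero]
    rintro ⟨x, y⟩ hxy
    have h1 := hli u x y (((hF u).2 x y).symm.trans hxy)
    exact Prod.ext h1.1 h1.2
  have hΦinj : ∀ u, Function.Injective (mfderiv 𝓘(ℝ, ℝ × ℝ) (𝓡 3) Φ u) := fun u => by
    have h1 : HasMFDerivAt 𝓘(ℝ, ℝ × ℝ) (𝓡 3) (F ∘ L) u _ := HasMFDerivAt.comp u (g := F)
      ((hF (L u)).1.mdifferentiableAt (by simp)).hasMFDerivAt L.hasFDerivAt.hasMFDerivAt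
    rw [show Φ = F ∘ L from rfl, h1.mfderiv]
    exact (hFinj (L u)).comp hLinj
  have hΦ : ∀ u w, Φ u = Φ w ↔ Circle.exp u.1 = Circle.exp w.1 ∧ Circle.exp u.2 = Circle.exp w.2 := by
    intro u w
    have hlin := b.linearIndependent
    rw [show (Φ u = Φ w ↔ _) ↔ (F (L u) = F (L w) ↔ _) from Iff.rfl, hb, Circle.exp_eq_exp,
      Circle.exp_eq_exp]
    have h1 : ∀ m n : ℤ, L u - L w = (m : ℝ) • b 0 + (n : ℝ) • b 1 ↔
        u.1 = w.1 + m * (2 * Real.pi) ∧ u.2 = w.2 + n * (2 * Real.pi) := by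
      intro m n
      have h2 : (m : ℝ) • b 0 + (n : ℝ) • b 1 = L (m * (2 * Real.pi), n * (2 * Real.pi)) := by
        rw [hL, smul_add, smul_smul, smul_smul]
        congr 2 <;> field_simp
      rw [h2, sub_eq_iff_eq_add, ← map_add, hLinj.eq_iff, Prod.ext_iff, Prod.fst_add, Prod.snd_add,
        add_comm, add_comm (n * (2 * Real.pi))]
    simp only [h1]
    exact ⟨fun ⟨m, n, h⟩ => ⟨⟨m, h.1⟩, n, h.2⟩, fun ⟨⟨m, h⟩, n, h'⟩ => ⟨m, n, h, h'⟩⟩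
  let ex : ℝ × ℝ → Circle × Circle := fun u => (Circle.exp u.1, Circle.exp u.2)
  have hex : ContMDiff 𝓘(ℝ, ℝ × ℝ) ((𝓡 1).prod (𝓡 1)) ∞ ex :=
    (contMDiff_circleExp.comp contDiff_fst.contMDiff).prodMk
      (contMDiff_circleExp.comp contDiff_snd.contMDiff)
  let T : Circle × Circle → M := fun z => Φ (Complex.arg z.1, Complex.arg z.2)
  have hTex : ∀ u, T (ex u) = Φ u := fun u => by
    rw [hΦ]; exact ⟨Circle.exp_arg _, Circle.exp_arg _⟩
  have hexs : Function.Surjective ex := fun z =>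
    ⟨(Complex.arg z.1, Complex.arg z.2), Prod.ext (Circle.exp_arg _) (Circle.exp_arg _)⟩
  have hT : ContMDiff ((𝓡 1).prod (𝓡 1)) (𝓡 3) ∞ T := by
    intro z₀
    -- `arg` jumps, but periodicity allows any other choice of angles. This one is smooth at `z₀`
    -- and gives the same `T` everywhere.
    let l : Circle × Circle → ℝ × ℝ := fun z =>
      (Complex.arg z₀.1 + Complex.arg (z.1 / z₀.1 : Circle),
        Complex.arg z₀.2 + Complex.arg (z.2 / z₀.2 : Circle))
    have hl : ContMDiffAt ((𝓡 1).prod (𝓡 1)) 𝓘(ℝ, ℝ × ℝ) ∞ l z₀ :=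
      ContMDiffAt.prodMk_space
        (contMDiffAt_const.add ((contMDiffAt_arg_div z₀.1).comp z₀ contMDiffAt_fst))
        (contMDiffAt_const.add ((contMDiffAt_arg_div z₀.2).comp z₀ contMDiffAt_snd))
    have hTl : T = Φ ∘ l := funext fun z => by
      rw [Function.comp_apply, hΦ]
      simp only [l, Circle.exp_add, Circle.exp_arg]
      exact ⟨(mul_div_cancel _ _).symm, (mul_div_cancel _ _).symm⟩
    rw [hTl]
    exact hΦc.contMDiffAt.comp z₀ hl
  refine ⟨T, isSmoothEmbedding_of_injective (by simp) hT ?_ ?_, ?_⟩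
  · intro z z' h
    obtain ⟨u, rfl⟩ := hexs z
    obtain ⟨w, rfl⟩ := hexs z'
    rw [hTex, hTex, hΦ] at h
    exact Prod.ext h.1 h.2
  · intro z
    obtain ⟨u, rfl⟩ := hexs z
    have h1 : HasMFDerivAt 𝓘(ℝ, ℝ × ℝ) (𝓡 3) (T ∘ ex) u _ := HasMFDerivAt.comp u (g := T)
      (hT.contMDiffAt.mdifferentiableAt (by simp)).hasMFDerivAt
      (hex.contMDiffAt.mdifferentiableAt (by simp)).hasMFDerivAt
    have h2 : T ∘ ex = Φ := funext hTex
    have h3 := h1.mfderiv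
    have hinj := hΦinj u
    rw [← h2, h3] at hinj
    set A := mfderiv 𝓘(ℝ, ℝ × ℝ) ((𝓡 1).prod (𝓡 1)) ex u
    set B := mfderiv ((𝓡 1).prod (𝓡 1)) (𝓡 3) T (ex u)
    have hA : Function.Injective A := Function.Injective.of_comp (f := B) hinj
    -- `dΦ = dT ∘ A` is injective, hence so is `A`; equal dimensions make `A` onto, and injectivity
    -- passes to `dT`.
    have hAs : Function.Surjective A := by
      have h4 : ∀ A' : ℝ × ℝ →L[ℝ] EuclideanSpace ℝ (Fin 1) × EuclideanSpace ℝ (Fin 1),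
          Function.Injective A' → Function.Surjective A' := fun A' hA' =>
        (LinearMap.injective_iff_surjective_of_finrank_eq_finrank (f := A'.toLinearMap)
          (by simp)).1 hA'
      exact h4 A hA
    intro v v' hv
    obtain ⟨x, rfl⟩ := hAs v
    obtain ⟨y, rfl⟩ := hAs v'
    rw [hinj hv]
  · ext q
    constructor
    · rintro ⟨z, rfl⟩
      exact ⟨_, rfl⟩
    · rintro ⟨v, rfl⟩
      obtain ⟨u, rfl⟩ := hLsurj v
      exact ⟨ex u, hTex u⟩

end Torus

/-! ### Orbits of plane actions on compact spaces. -/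

section Orbits

variable {S : Type*} {g : ℝ × ℝ → S → S}

/-- The orbit of `p` under the action `g`. -/
def orbit (g : ℝ × ℝ → S → S) (p : S) : Set S := range fun u => g u p

theorem mem_orbit_self (h0 : ∀ q, g 0 q = q) (p : S) : p ∈ orbit g p := ⟨0, h0 p⟩

theorem orbit_eq_of_mem (hadd : ∀ u w q, g (u + w) q = g u (g w q))
    {p q : S} (h : q ∈ orbit g p) : orbit g q = orbit g p := by
  obtain ⟨u, rfl⟩ := h
  ext x
  constructor
  · rintro ⟨w, rfl⟩
    exact ⟨w + u, hadd w u p⟩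
  · rintro ⟨w, rfl⟩
    refine ⟨w - u, ?_⟩
    change g (w - u) (g u p) = _
    rw [← hadd, sub_add_cancel]

theorem iUnion_image_ball (p : S) :
    ⋃ n : ℕ, (fun u => g u p) '' Metric.ball 0 n = orbit g p := by
  rw [← image_iUnion, Metric.iUnion_ball_nat, image_univ]; rfl

variable [TopologicalSpace S]

theorem isOpen_image_ball (hadd : ∀ u w q, g (u + w) q = g u (g w q))
    (hopen : ∀ p, ∀ ε > 0, (fun u => g u p) '' Metric.ball 0 ε ∈ 𝓝 p) (p : S) (r : ℝ) :
    IsOpen ((fun u => g u p) '' Metric.ball 0 r) := by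
  rw [isOpen_iff_mem_nhds]
  rintro _ ⟨u, hu, rfl⟩
  rw [mem_ball_zero_iff] at hu
  refine mem_of_superset (hopen (g u p) (r - ‖u‖) (sub_pos.2 hu)) ?_
  rintro _ ⟨w, hw, rfl⟩
  rw [mem_ball_zero_iff] at hw
  refine ⟨w + u, ?_, hadd w u p⟩
  rw [mem_ball_zero_iff]
  exact lt_of_le_of_lt (norm_add_le w u) (by linarith)

theorem isOpen_orbit (hadd : ∀ u w q, g (u + w) q = g u (g w q))
    (hopen : ∀ p, ∀ ε > 0, (fun u => g u p) '' Metric.ball 0 ε ∈ 𝓝 p) (p : S) :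
    IsOpen (orbit g p) := by
  rw [← iUnion_image_ball]
  exact isOpen_iUnion fun n => isOpen_image_ball hadd hopen p n

/-- The complement of an orbit is a union of orbits, which are open. -/
theorem isClosed_orbit (h0 : ∀ q, g 0 q = q) (hadd : ∀ u w q, g (u + w) q = g u (g w q))
    (hopen : ∀ p, ∀ ε > 0, (fun u => g u p) '' Metric.ball 0 ε ∈ 𝓝 p) (p : S) :
    IsClosed (orbit g p) := by
  rw [← isOpen_compl_iff, isOpen_iff_mem_nhds]
  intro q hq
  refine mem_of_superset ((isOpen_orbit hadd hopen q).mem_nhds (mem_orbit_self h0 q)) ?_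
  intro x hx hxp
  apply hq
  rw [← orbit_eq_of_mem hadd hxp, orbit_eq_of_mem hadd hx]
  exact mem_orbit_self h0 q

theorem finite_range_orbit [CompactSpace S] (h0 : ∀ q, g 0 q = q)
    (hadd : ∀ u w q, g (u + w) q = g u (g w q))
    (hopen : ∀ p, ∀ ε > 0, (fun u => g u p) '' Metric.ball 0 ε ∈ 𝓝 p) :
    (range (orbit g)).Finite := by
  obtain ⟨t, ht⟩ := isCompact_univ.elim_finite_subcover (orbit g) (isOpen_orbit hadd hopen)
    fun q _ => mem_iUnion.2 ⟨q, mem_orbit_self h0 q⟩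
  refine (t.finite_toSet.image (orbit g)).subset ?_
  rintro _ ⟨q, rfl⟩
  obtain ⟨p, hp⟩ := mem_iUnion.1 (ht (mem_univ q))
  obtain ⟨hpt, hq⟩ := mem_iUnion.1 hp
  exact ⟨p, hpt, (orbit_eq_of_mem hadd hq).symm⟩

/-- An orbit of a locally free action of the plane with open orbits on a compact space is doubly
periodic. -/
theorem exists_period_basis [CompactSpace S] (h0 : ∀ q, g 0 q = q)
    (hadd : ∀ u w q, g (u + w) q = g u (g w q))
    (hopen : ∀ p, ∀ ε > 0, (fun u => g u p) '' Metric.ball 0 ε ∈ 𝓝 p) (p : S)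
    {δ : ℝ} (hδ : 0 < δ) (hinj : InjOn (fun u => g u p) (Metric.ball 0 δ)) :
    ∃ b : Module.Basis (Fin 2) ℝ (ℝ × ℝ), ∀ u w, g u p = g w p ↔
      ∃ m n : ℤ, u - w = (m : ℝ) • b 0 + (n : ℝ) • b 1 := by
  have hneg : ∀ {u q q'}, g u q = q' → g (-u) q' = q := by
    rintro u q _ rfl
    rw [← hadd, neg_add_cancel, h0]
  have hsub : ∀ u w, g u p = g w p ↔ g (u - w) p = p := by
    intro u w
    constructor
    · intro h
      rw [sub_eq_neg_add, hadd, h, hneg rfl]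
    · intro h
      rw [← add_sub_cancel w u, hadd, h]
  let Λ₀ : AddSubgroup (ℝ × ℝ) :=
    { carrier := {u | g u p = p}
      zero_mem' := h0 p
      add_mem' := fun {u w} hu hw => by
        change g (u + w) p = p
        rw [hadd, show g w p = p from hw, show g u p = p from hu]
      neg_mem' := fun {u} hu => hneg hu }
  let Λ := AddSubgroup.toIntSubmodule Λ₀
  have hΛ : ∀ u, u ∈ Λ ↔ g u p = p := fun u => Iff.rfl
  -- The orbit is compact and is exhausted by the open images of balls, so one ball suffices. Hence
  -- the period group is cocompact; `hinj` makes it discrete.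
  obtain ⟨N, hN⟩ : ∃ N : ℕ, orbit g p ⊆ (fun u => g u p) '' Metric.ball 0 N := by
    refine (isClosed_orbit h0 hadd hopen p).isCompact.elim_directed_cover _
      (fun n : ℕ => isOpen_image_ball hadd hopen p n) (iUnion_image_ball p).ge ?_
    exact Monotone.directed_le fun m n hmn =>
      image_mono (Metric.ball_subset_ball (Nat.cast_le.2 hmn))
  obtain ⟨b, hb⟩ := exists_lattice_basis Λ hδ (N := N)
    (fun u hu hn => hinj (mem_ball_zero_iff.2 hn) (Metric.mem_ball_self hδ)
      (((hΛ u).1 hu).trans (h0 p).symm))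
    (fun v => by
      obtain ⟨w, hw, hwv⟩ := hN ⟨v, rfl⟩
      exact ⟨w, mem_ball_zero_iff.1 hw, (hΛ _).2 ((hsub v w).1 hwv.symm)⟩)
  exact ⟨b, fun u w => by rw [hsub, ← hΛ, hb]⟩

end Orbits

/-! ### Level sets as finite unions of tori. -/

section LevelTori

variable {M : Type*} [TopologicalSpace M] [T2Space M] [ChartedSpace E3 M] [IsManifold (𝓡 3) ∞ M]
variable {R X : VField M} {f : M → ℝ}

/-- A compact level set is a finite disjoint union of tori if it carries two commuting fields
which are tangent to it and linearly independent along it. -/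
theorem isFiniteDisjointUnionOfTori_level (hR : ∀ q, SmoothAt R q) (hX : ∀ q, SmoothAt X q)
    (hf : ∀ q, ContMDiffAt (𝓡 3) 𝓘(ℝ, ℝ) ∞ f q) (hRX : ∀ q, mlieBracket (𝓡 3) R X q = 0)
    (hfR : ∀ q, mvfderiv (𝓡 3) f q (R q) = 0) (hfX : ∀ q, mvfderiv (𝓡 3) f q (X q) = 0)
    {c : ℝ} (hc : IsCompact (f ⁻¹' {c})) (hfp : ∀ p ∈ f ⁻¹' {c}, mvfderiv (𝓡 3) f p ≠ 0)
    (hli : ∀ p ∈ f ⁻¹' {c}, ∀ a b : ℝ, a • R p + b • X p = 0 → a = 0 ∧ b = 0) :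
    IsFiniteDisjointUnionOfTori (f ⁻¹' {c}) := by
  have hch : ∀ p ∈ f ⁻¹' {c}, ∃ δ G θ U, IsFlowChart R X f p δ G θ U := fun p hp =>
    exists_isFlowChart hR hX hf hRX hfR hfX (hfp p hp) (hli p hp)
  obtain ⟨g, h0, hadd, hg⟩ := exists_flow_action hR hX hc hch
  have hcs : CompactSpace (f ⁻¹' {c}) := isCompact_iff_compactSpace.1 hc
  have hloc : ∀ p : f ⁻¹' {c}, ∃ δ > 0, InjOn (fun u => g u p) (Metric.ball 0 δ) ∧
      ∀ ε > 0, (fun u => g u p) '' Metric.ball 0 ε ∈ 𝓝 p := by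
    intro p
    obtain ⟨δ, G, θ, U, h⟩ := hch p p.2
    -- By uniqueness the action is given near `p` by the flow chart. Its inverse `θ` yields both
    -- local injectivity and openness of orbits.
    have hG : EqOn (fun u => (g u p : M)) G (Metric.ball 0 δ) :=
      IsFlowMap.eqOn hR hX (fun u _ => hg p u) h.isFlowMap (by
        simp only [h0, h.apply_zero])
    refine ⟨δ, h.pos, ?_, fun ε hε => ?_⟩
    · intro u hu w hw huw
      have h1 : G u = G w := by
        rw [← hG hu, ← hG hw]; exact congrArg Subtype.val huw
      rw [← h.left_inv u hu, h1, h.left_inv w hw]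
    · have hθ : ContinuousAt θ p := h.continuousOn.continuousAt (h.isOpen.mem_nhds h.mem)
      have h1 : ∀ᶠ q in 𝓝 (p : M), θ q ∈ Metric.ball 0 ε ∧ q ∈ U :=
        (hθ.eventually_mem (by rw [h.apply_self]; exact Metric.ball_mem_nhds 0 hε)).and
          (h.isOpen.mem_nhds h.mem)
      filter_upwards [continuous_subtype_val.continuousAt.eventually h1] with q hq
      have hq2 : f q = f p := q.2.trans p.2.symm
      refine ⟨θ q, hq.1, Subtype.ext ?_⟩
      exact (hG (h.mem_ball q hq.2 hq2)).trans (h.right_inv q hq.2 hq2)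
  have hopen := fun p => (hloc p).choose_spec.2.2
  have htorus : ∀ p : f ⁻¹' {c}, ∃ T : Circle × Circle → M,
      Manifold.IsSmoothEmbedding ((𝓡 1).prod (𝓡 1)) (𝓡 3) ∞ T ∧
        range T = Subtype.val '' orbit g p := by
    intro p
    obtain ⟨δ, hδ, hinj, -⟩ := hloc p
    obtain ⟨b, hb⟩ := exists_period_basis h0 hadd hopen p hδ hinj
    obtain ⟨T, hT, hrange⟩ := exists_torus_embedding (hg p) (fun u => hli _ (g u p).2) b
      (fun u w => by rw [← hb, Subtype.ext_iff])
    refine ⟨T, hT, hrange.trans ?_⟩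
    rw [orbit, ← range_comp]
    rfl
  choose T hT hrange using htorus
  have hfin : Finite (range (orbit g)) := finite_range_orbit h0 hadd hopen
  obtain ⟨n, ⟨e⟩⟩ := Finite.exists_equiv_fin (range (orbit g))
  choose r hr using fun O : range (orbit g) => O.2
  refine ⟨n, fun i => T (r (e.symm i)), fun i => hT _, ?_, ?_⟩
  · intro i j hij
    rw [Set.disjoint_left]
    intro x hxi hxj
    rw [hrange] at hxi hxj
    obtain ⟨y, hyi, rfl⟩ := hxi
    obtain ⟨y', hyj, hyy⟩ := hxj
    obtain rfl := Subtype.ext hyy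
    apply hij
    apply e.symm.injective
    apply Subtype.ext
    rw [← hr, ← hr, ← orbit_eq_of_mem hadd hyi, orbit_eq_of_mem hadd hyj]
  · ext x
    rw [mem_iUnion]
    constructor
    · intro hx
      refine ⟨e ⟨orbit g ⟨x, hx⟩, mem_range_self _⟩, ?_⟩
      rw [hrange, hr, Equiv.symm_apply_apply]
      exact ⟨⟨x, hx⟩, mem_orbit_self h0 _, rfl⟩
    · rintro ⟨i, hi⟩
      rw [hrange] at hi
      obtain ⟨y, -, rfl⟩ := hi
      exact y.2

end LevelTori

/-! ### Application to the characteristic surface. -/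

section Main

variable {M : Type*} [TopologicalSpace M] [ChartedSpace E3 M] [IsManifold (𝓡 3) ∞ M]

variable [RiemannianBundle (fun p : M => TangentSpace (𝓡 3) p)]
  [IsContMDiffRiemannianBundle (𝓡 3) ∞ E3 (fun p : M => TangentSpace (𝓡 3) p)]
  {o : (p : M) → Orientation ℝ (TangentSpace (𝓡 3) p) (Fin 3)} {α : OneForm M} {μ : M → ℝ}

theorem isSubellipticSolution_pair (hα : IsContactForm α) (hμ : IsAdapted o α μ)
    {X : VField M} (hX : X.IsSmooth) (hX0 : ∀ p, X p ≠ 0) (hXα : Preserves X α) :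
    IsSubellipticSolution o X μ (pair α X) where
  smooth := fun p => hα.smooth.pair_smoothAt (hX p)
  equation := subelliptic_equation hα hμ hX hX0 hXα

theorem isFiniteDisjointUnionOfTori_zero [T2Space M] [CompactSpace M] (hα : IsContactForm α)
    (hμ : IsAdapted o α μ) {X : VField M} (hX : X.IsSmooth) (hX0 : ∀ p, X p ≠ 0)
    (hXα : Preserves X α) : IsFiniteDisjointUnionOfTori (pair α X ⁻¹' {0}) := by
  have hf : ∀ q, ContMDiffAt (𝓡 3) 𝓘(ℝ, ℝ) ∞ (pair α X) q :=
    fun q => hα.smooth.pair_smoothAt (hX q)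
  have hd : ∀ q u, mvfderiv (𝓡 3) (pair α X) q u = - dForm α q (X q) u := fun q u =>
    mvfderiv_eq_neg_dForm hα.smooth (hX.smoothAt q).diffAt hXα u
  have halt : ∀ q (u v : TangentSpace (𝓡 3) q), dForm α q u u = 0 ∧
      dForm α q u v = - dForm α q v u := by
    intro q u v
    obtain ⟨B, hB, hB0⟩ := exists_bilin_dForm (α := α) (p := q) fun hW => hα.smooth.pair_diffAt hW
    have h1 := hB0 (u + v)
    simp only [map_add, LinearMap.add_apply, hB0] at h1
    simp only [hB]
    exact ⟨hB0 u, by linarith⟩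
  refine isFiniteDisjointUnionOfTori_level (R := reeb α) (X := X) (reeb_smoothAt hα) hX.smoothAt hf
    (fun q => ?_) (fun q => ?_) (fun q => ?_) ?_ (fun p hp h0 => ?_) (fun p hp a b hab => ?_)
  · rw [mlieBracket_swap_apply, mlieBracket_reeb hα hμ hX hXα, neg_zero]
  · rw [hd, (halt q _ _).2, dForm_reeb hα hμ, neg_zero, neg_zero]
  · rw [hd, (halt q _ (X q)).1, neg_zero]
  · have hc : Continuous (pair α X) := continuous_iff_continuousAt.2 fun q => (hf q).continuousAt
    exact (isClosed_singleton.preimage hc).isCompact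
  -- If `df` vanished at `p`, then `ι_X dα = 0` there; together with `α(X) = 0` this gives `X p =
  -- 0`.
  · refine hX0 p (eq_zero_of_dForm_eq_zero hα hμ hp fun v => ?_)
    have h1 := hd p v
    rw [h0] at h1
    exact neg_eq_zero.1 h1.symm
  -- Applying `α` isolates the coefficient of the Reeb field, as `α(R) = 1` and `α(X) = 0`.
  · have h1 := congrArg (α p) hab
    rw [map_add, map_smul, map_smul, apply_reeb hα, show α p (X p) = 0 from hp, map_zero,
      smul_zero, add_zero, smul_eq_mul, mul_one] at h1
    subst h1
    rw [zero_smul, zero_add] at hab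
    exact ⟨rfl, (smul_eq_zero.1 hab).resolve_right (hX0 p)⟩

end Main

end ContactGeometry

end

theorem mainTheorem8
    {M : Type*} [TopologicalSpace M] [T2Space M] [CompactSpace M]
    [ChartedSpace (EuclideanSpace ℝ (Fin 3)) M] [IsManifold (𝓡 3) ∞ M]
    [RiemannianBundle (fun p : M => TangentSpace (𝓡 3) p)]
    [IsContMDiffRiemannianBundle (𝓡 3) ∞ (EuclideanSpace ℝ (Fin 3))
      (fun p : M => TangentSpace (𝓡 3) p)]
    (o : (p : M) → Orientation ℝ (TangentSpace (𝓡 3) p) (Fin 3))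
    (ho : ContactGeometry.IsOrientation o)
    (α : ContactGeometry.OneForm M) (hα : ContactGeometry.IsContactForm α)
    (μ : M → ℝ) (hμ : ContactGeometry.IsAdapted o α μ)
    (X : ContactGeometry.VField M) (hX : X.IsSmooth) (hX0 : ∀ p, X p ≠ 0)
    (hXα : ContactGeometry.Preserves X α)
    (f : M → ℝ) (hf : f = fun p => α p (X p)) :
    ContactGeometry.charSurface α X = f ⁻¹' {0} ∧
    ContactGeometry.IsSubellipticSolution o X μ f ∧
    ContactGeometry.IsFiniteDisjointUnionOfTori (ContactGeometry.charSurface α X) := by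
  subst hf
  -- Both descriptions of the surface unfold to `α p (X p) = 0`.
  exact ⟨rfl, ContactGeometry.isSubellipticSolution_pair hα hμ hX hX0 hXα,
    ContactGeometry.isFiniteDisjointUnionOfTori_zero hα hμ hX hX0 hXα⟩
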